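/- Let $f\in C^1[0,\infty)$ with $f>0$ on $[0,\infty)$, put $g:=\log f$ and $H:=\dfrac{g\,g''}{(g')^2}$, and assume: (G1) for all sufficiently large $s$ one has $g(s)>0$ and $\int_s^\infty \frac{du}{g(u)}<\infty$, and the limit $\lim_{s\to\infty}H(s)$ exists and equals $\frac1q$ for some real number $q\neq 0$; (G2) there are $C>0$ and $s_0>0$ such that $g\in C^5(s_0,\infty)$ and $|H^{(k)}(s)|<C\left(\frac{g'(s)}{g(s)}\right)^k$ for all $k\in\{1,2,3\}$ and $s>s_0$. Let $g^{-1}(\rho)$ denote, for large $\rho$, the (unique) point $s\ge 0$ with $g(s)=\rho$. Consider the equation $$-y''(\rho)=\tfrac14\,f(y(\rho))\,e^{-\rho}, \qquad (\ast)$$ where a solution on $[\Lambda,\infty)$ is a twice differentiable function $y:[\Lambda,\infty)\to[0,\infty)$ satisfying $(\ast)$ (with one-sided derivatives at $\Lambda$). For $\varepsilon\in(0,\frac12]$ consider the expansion, as $\rho\to\infty$, $$y(\rho)=g^{-1}(\rho)+\frac{1}{g'(g^{-1}(\rho))}\left(-2\log\rho-\log\frac{g'(g^{-1}(\rho))}{\rho}+\log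 H(g^{-1}(\rho))+\log 4\right)+o\!\left(\frac{1}{\rho^{1-\varepsilon}\,g'(g^{-1}(\rho))}\right). \qquad (E_\varepsilon)$$ Then: 1. There exist $\Lambda_\infty>0$ and a solution $y_\infty$ of $(\ast)$ on $[\Lambda_\infty,\infty)$ that satisfies $(E_\varepsilon)$ for every $\varepsilon\in(0,\frac12]$. 2. The solution satisfying $(E_{1/2})$ is unique: for every $\Lambda\in\mathbb R$, any two solutions of $(\ast)$ on $[\Lambda,\infty)$ that satisfy $(E_{1/2})$ coincide on $[\Lambda,\infty)$. -/

import Mathlib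

open Set Filter Topology MeasureTheory Asymptotics

noncomputable section

/-- The exponent `g = log f` of the nonlinearity `f`. -/
def logNonlin (f : ℝ → ℝ) (s : ℝ) : ℝ := Real.log (f s)

/-- `H = g g'' / (g')²`. -/
def ratioH (g : ℝ → ℝ) (s : ℝ) : ℝ := g s * deriv (deriv g) s / (deriv g s) ^ 2

/-- The standing assumption on the nonlinearity: `f ∈ C¹[0, ∞)` and `f > 0` on `[0, ∞)`.
The values of `f` on the negative half-line are irrelevant. -/
structure IsNonlinearity (f : ℝ → ℝ) : Prop where
  contDiffOn : ContDiffOn ℝ 1 f (Ici 0)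
  pos : ∀ s, 0 ≤ s → 0 < f s

/-- Condition (G1): `g > 0` and `∫_s^∞ du / g(u) < ∞` for all large `s`, and `H` has a limit
of the form `1 / q` at infinity, with `q` a (finite, nonzero) real number. -/
structure CondG1 (g : ℝ → ℝ) : Prop where
  pos : ∀ᶠ s in atTop, 0 < g s
  integrable : ∀ᶠ s in atTop, IntegrableOn (fun u => 1 / g u) (Ioi s)
  limit : ∃ q : ℝ, q ≠ 0 ∧ Tendsto (ratioH g) atTop (𝓝 (1 / q))

/-- Condition (G2): for some `C > 0` and `s₀ > 0`, `g` is `C⁵` on `(s₀, ∞)` and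
`|H⁽ᵏ⁾| < C (g' / g)ᵏ` there for `k = 1, 2, 3`. -/
def CondG2 (g : ℝ → ℝ) : Prop :=
  ∃ C > 0, ∃ s₀ > 0, ContDiffOn ℝ 5 g (Ioi s₀) ∧
    ∀ k ∈ ({1, 2, 3} : Set ℕ), ∀ s, s₀ < s →
      |iteratedDeriv k (ratioH g) s| < C * (deriv g s / g s) ^ k

/-- The inverse function of `g : [0, ∞) → ℝ`. Only its values at large arguments matter, where
under the conditions above there is exactly one preimage in `[0, ∞)`. -/
def invG (g : ℝ → ℝ) (ρ : ℝ) : ℝ := Function.invFunOn g (Ici 0) ρ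

/-- `y` is a (classical, `[0, ∞)`-valued) solution of `-y'' = (1/4) f(y) e^{-ρ}` on `[Λ, ∞)`.
Here `z` is the derivative of `y`; derivatives at the end point `Λ` are one-sided. -/
def IsODESolution (f : ℝ → ℝ) (Λ : ℝ) (y : ℝ → ℝ) : Prop :=
  (∀ ρ, Λ ≤ ρ → 0 ≤ y ρ) ∧
  ∃ z : ℝ → ℝ, ∀ ρ, Λ ≤ ρ →
    HasDerivWithinAt y (z ρ) (Ici Λ) ρ ∧
    HasDerivWithinAt z (-(1 / 4 * f (y ρ) * Real.exp (-ρ))) (Ici Λ) ρ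

/-- The explicit part of the expansion:
`g⁻¹(ρ) + (1 / g'(g⁻¹(ρ))) (-2 log ρ - log (g'(g⁻¹(ρ)) / ρ) + log H(g⁻¹(ρ)) + log 4)`. -/
def mainPart (g : ℝ → ℝ) (ρ : ℝ) : ℝ :=
  invG g ρ + 1 / deriv g (invG g ρ) *
    (-2 * Real.log ρ - Real.log (deriv g (invG g ρ) / ρ)
      + Real.log (ratioH g (invG g ρ)) + Real.log 4)

/-- `y = mainPart + o(1 / (ρ^{1-ε} g'(g⁻¹(ρ))))` as `ρ → ∞`. -/
def HasExpansion (g : ℝ → ℝ) (ε : ℝ) (y : ℝ → ℝ) : Prop :=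
  (fun ρ => y ρ - mainPart g ρ) =o[atTop]
    (fun ρ => 1 / (ρ ^ (1 - ε) * deriv g (invG g ρ)))

end

/-!
Write `G = g⁻¹`, `φ = G' = 1 / g'(G)` and `h = H(G)`. The definition of `H` says that
`φ' = -h φ / ρ`, and the bounds on `H'`, `H''`, `H'''` say that `h` is bounded together with its
first three derivatives under `ρ d/dρ`; moreover `ρ h' → 0` by Landau's inequality. Everything
about the equation is deduced from these facts, collected in `InverseProfile`; the hypotheses enter
through `exists_inverseProfile`, where integrability of `1 / g` forces `g` to be convex and
increasing near infinity.

*Approximate solutions.* The step `Y ↦ G (ρ + log (-4 Y''))` inverts the right-hand side of the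
equation. Its first step from `G` gives, to first order, the leading part
`m = G + φ log (4 h φ / ρ)`, which is `mainPart`. One more step gives `Y` with
`m'' = -(1/4) f(Y) exp(-ρ)` exactly, and `Y - m = O(φ log² ρ / ρ)`,
`Y' - m' = O(φ log² ρ / ρ²)` (`InverseProfile.exists_corrected`); the second bound uses three
derivatives of `h`.

*Energy.* For `y = Y + u` and `y' = m' + p` the equation becomes `u' = p + (m' - Y')`,
`p' = -(h / ρ) u - (small)`, a slowly varying oscillator; the remainder is controlled in a tube
of width `o(φ / √ρ)` around `m` (`InverseProfile.exists_nonlinearity_bound`). The residual appears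
in the equation for `u` and not in that for `p`: this saves the factor `√ρ` that a direct estimate
of the oscillating solution would lose. Since `ρ h' → 0`, the energy `p² + (h / ρ) u²` grows at most
like `ρ ^ (-3/2)` backwards in `ρ` (`energy_backward`).

*Existence.* The problems with zero data at `ρ = n` have solutions bounded by the energy estimate
uniformly in `n`, and the same estimate applied to differences makes them a uniform Cauchy
sequence (`exists_decaying_solution`). The limit satisfies `u = O(φ log² ρ / ρ)`, which is within
the error allowed by every `ε > 0`.

*Uniqueness.* The difference of two solutions has energy `O(ρ ^ (-2))` along a sequence, by the
mean value theorem on steps of length `√ρ`. This is smaller than `ρ ^ (-3/2)`, so the difference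
vanishes near infinity (`InverseProfile.eventually_eq_of_isLittleO`), hence everywhere by uniqueness
for the initial value problem.
-/

/-! ### Truncation, global solvability and the backward energy estimate -/

/-- The truncation of `x` to the interval `[-c, c]`. -/
noncomputable def clamp (c x : ℝ) : ℝ := max (-c) (min x c)

lemma abs_clamp_le {c : ℝ} (hc : 0 ≤ c) (x : ℝ) : |clamp c x| ≤ c := by
  unfold clamp
  rw [abs_le]
  exact ⟨le_max_left _ _, max_le (by linarith) (min_le_right _ _)⟩

lemma clamp_of_abs_le {c x : ℝ} (h : |x| ≤ c) : clamp c x = x := by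
  unfold clamp
  rw [abs_le] at h
  rw [min_eq_left h.2, max_eq_right h.1]

lemma abs_clamp_sub_clamp_le (c x y : ℝ) : |clamp c x - clamp c y| ≤ |x - y| := by
  unfold clamp
  calc |max (-c) (min x c) - max (-c) (min y c)| ≤ |min x c - min y c| := by
        simpa [max_comm (-c)] using abs_max_sub_max_le_abs (min x c) (min y c) (-c)
    _ ≤ max |x - y| |c - c| := abs_min_sub_min_le_max _ _ _ _
    _ = |x - y| := by simp

lemma clamp_zero {c : ℝ} (hc : 0 ≤ c) : clamp c 0 = 0 := clamp_of_abs_le (by simpa using hc)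

lemma abs_clamp_le_abs {c : ℝ} (hc : 0 ≤ c) (x : ℝ) : |clamp c x| ≤ |x| := by
  simpa [clamp_zero hc] using abs_clamp_sub_clamp_le c x 0

/-- Global solvability on a compact interval for a globally Lipschitz planar vector field.
The field is truncated outside a ball that Grönwall's inequality shows no solution can leave;
the truncated field is bounded, so a single application of the Picard-Lindelöf theorem covers
the whole interval. -/
lemma exists_solution_Icc_initial {F : ℝ → ℝ × ℝ → ℝ × ℝ} {a b : ℝ} (hab : a ≤ b) {K : NNReal}
    (hLip : ∀ t ∈ Icc a b, LipschitzWith K (F t))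
    (hcont : ∀ x, ContinuousOn (fun t => F t x) (Icc a b)) (x₀ : ℝ × ℝ) :
    ∃ x : ℝ → ℝ × ℝ, x a = x₀ ∧ ∀ t ∈ Icc a b, HasDerivWithinAt x (F t (x t)) (Icc a b) t := by
  obtain ⟨M, hM⟩ := isCompact_Icc.exists_bound_of_continuousOn (hcont 0)
  have hM0 : 0 ≤ M := (norm_nonneg _).trans (hM a ⟨le_rfl, hab⟩)
  set P : ℝ := gronwallBound ‖x₀‖ K M (b - a) with hP
  have hmono := gronwallBound_mono (norm_nonneg x₀) hM0 K.2
  have hP0 : 0 ≤ P := by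
    have h := hmono (sub_nonneg.2 hab)
    rw [gronwallBound_x0] at h
    exact (norm_nonneg _).trans h
  set T : ℝ × ℝ → ℝ × ℝ := fun x => (clamp P x.1, clamp P x.2) with hT
  have hTlip : LipschitzWith 1 T := by
    refine LipschitzWith.of_dist_le_mul fun x y => ?_
    simp only [hT, Prod.dist_eq, Real.dist_eq, NNReal.coe_one, one_mul]
    exact max_le_max (abs_clamp_sub_clamp_le _ _ _) (abs_clamp_sub_clamp_le _ _ _)
  have hTP : ∀ x, ‖T x‖ ≤ P := fun x => by
    simp only [hT, Prod.norm_def, Real.norm_eq_abs]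
    exact max_le (abs_clamp_le hP0 _) (abs_clamp_le hP0 _)
  have hTn : ∀ x, ‖T x‖ ≤ ‖x‖ := fun x => by
    simp only [hT, Prod.norm_def, Real.norm_eq_abs]
    exact max_le_max (abs_clamp_le_abs hP0 _) (abs_clamp_le_abs hP0 _)
  have hTe : ∀ x, ‖x‖ ≤ P → T x = x := fun x hx => by
    simp only [Prod.norm_def, Real.norm_eq_abs, max_le_iff] at hx
    simp only [hT, clamp_of_abs_le hx.1, clamp_of_abs_le hx.2]
  have hgrow : ∀ t ∈ Icc a b, ∀ x, ‖F t x‖ ≤ K * ‖x‖ + M := fun t ht x => by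
    have h1 := (hLip t ht).dist_le_mul x 0
    rw [dist_zero_right, dist_eq_norm] at h1
    have h2 := norm_sub_norm_le (F t x) (F t 0)
    linarith [hM t ht]
  set L : NNReal := ⟨K * P + M, by positivity⟩ with hL
  have hPL : IsPicardLindelof (fun t x => F t (T x)) (⟨a, le_rfl, hab⟩ : Icc a b) x₀
      (L * ⟨b - a, sub_nonneg.2 hab⟩) 0 L K := by
    refine ⟨fun t ht => ?_, fun x _ => hcont _, fun t ht x _ => ?_, ?_⟩
    · have := (hLip t ht).comp hTlip
      rw [mul_one] at this
      exact this.lipschitzOnWith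
    · refine (hgrow t ht _).trans ?_
      show _ ≤ K * P + M
      gcongr
      exact hTP x
    · simp only [sub_self, NNReal.coe_zero, sub_zero]
      rw [max_eq_left (sub_nonneg.2 hab)]
      exact le_rfl
  obtain ⟨x, hx0, hx⟩ := hPL.exists_eq_forall_mem_Icc_hasDerivWithinAt₀
  refine ⟨x, hx0, fun t ht => ?_⟩
  have hbound := norm_le_gronwallBound_of_norm_deriv_right_le (f := x)
    (f' := fun t => F t (T (x t))) (δ := ‖x₀‖) (K := K) (ε := M) (a := a) (b := b)
    (fun t ht => (hx t ht).continuousWithinAt)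
    (fun t ht => (hx t ⟨ht.1, ht.2.le⟩).mono_of_mem_nhdsWithin (Icc_mem_nhdsGE_of_mem ht))
    (by rw [← hx0])
    (fun t ht => (hgrow t ⟨ht.1, ht.2.le⟩ _).trans (by gcongr; exact hTn _)) t ht
  have := hx t ht
  rwa [hTe _ (hbound.trans (hmono (by linarith [ht.2])))] at this

lemma exists_solution_Icc_terminal {F : ℝ → ℝ × ℝ → ℝ × ℝ} {a b : ℝ} (hab : a ≤ b) {K : NNReal}
    (hLip : ∀ t ∈ Icc a b, LipschitzWith K (F t))
    (hcont : ∀ x, ContinuousOn (fun t => F t x) (Icc a b)) (x₀ : ℝ × ℝ) :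
    ∃ x : ℝ → ℝ × ℝ, x b = x₀ ∧ ∀ t ∈ Icc a b, HasDerivWithinAt x (F t (x t)) (Icc a b) t := by
  have hmaps : MapsTo (fun t : ℝ => -t) (Icc (-b) (-a)) (Icc a b) := fun t ht =>
    ⟨by linarith [ht.2], by linarith [ht.1]⟩
  have hmaps' : MapsTo (fun t : ℝ => -t) (Icc a b) (Icc (-b) (-a)) := fun t ht =>
    ⟨by linarith [ht.2], by linarith [ht.1]⟩
  obtain ⟨x, hx0, hx⟩ := exists_solution_Icc_initial (F := fun t x => -F (-t) x) (a := -b)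
    (b := -a) (K := K) (by linarith)
    (fun t ht => (hLip _ (hmaps ht)).neg)
    (fun x => ((hcont x).comp continuous_neg.continuousOn hmaps).neg) x₀
  refine ⟨fun t => x (-t), hx0, fun t ht => ?_⟩
  have h := (hx (-t) (hmaps' ht)).scomp t ((hasDerivAt_id t).neg.hasDerivWithinAt) hmaps'
  simp only [neg_neg, neg_smul, one_smul] at h
  exact h

/-- Backward energy estimate for the perturbed oscillator `u' = p + d`, `p' = -a u - b`, where
`t |a'| ≤ (5/4) a`: going from `R` down to `r`, the energy `p ^ 2 + a u ^ 2` grows at most like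
`t ^ (-3 / 2)`, up to the contribution of the forcing `d`. The exponent `3/2` is `5/4` plus `1/8` for
`b` and `1/8` for `d`. -/
lemma energy_backward {r R D : ℝ} (hr : 0 < r) (hrR : r ≤ R) {u p a a' b d : ℝ → ℝ}
    (hu : ∀ t ∈ Icc r R, HasDerivWithinAt u (p t + d t) (Icc r R) t)
    (hp : ∀ t ∈ Icc r R, HasDerivWithinAt p (-(a t * u t) - b t) (Icc r R) t)
    (ha : ∀ t ∈ Icc r R, HasDerivAt a (a' t) t) (hapos : ∀ t ∈ Icc r R, 0 < a t)
    (ha' : ∀ t ∈ Icc r R, t * |a' t| ≤ 5 / 4 * a t)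
    (hb : ∀ t ∈ Icc r R, 8 * t * |b t| ≤ √(a t) * |u t|)
    (hd : ∀ t ∈ Icc r R, a t * d t ^ 2 * √t ≤ D / t ^ 4) :
    r * √r * (p r ^ 2 + a r * u r ^ 2) ≤ R * √R * (p R ^ 2 + a R * u R ^ 2) + 8 * D / r := by
  set E : ℝ → ℝ := fun t => p t ^ 2 + a t * u t ^ 2 with hE
  set W : ℝ → ℝ := fun t => t * √t * E t - 8 * D / t with hW
  have hcont : ContinuousOn W (Icc r R) := by
    have h1 : ContinuousOn u (Icc r R) := fun t ht => (hu t ht).continuousWithinAt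
    have h2 : ContinuousOn p (Icc r R) := fun t ht => (hp t ht).continuousWithinAt
    have h3 : ContinuousOn a (Icc r R) := fun t ht => (ha t ht).continuousAt.continuousWithinAt
    have h4 : ContinuousOn (fun t : ℝ => 8 * D / t) (Icc r R) :=
      continuousOn_const.div continuousOn_id fun t ht => (hr.trans_le ht.1).ne'
    have h5 : ContinuousOn (fun t : ℝ => t * √t) (Icc r R) := by fun_prop
    exact (h5.mul ((h2.pow 2).add (h3.mul (h1.pow 2)))).sub h4
  have hmono : MonotoneOn W (Icc r R) := by
    refine monotoneOn_of_hasDerivWithinAt_nonneg (convex_Icc r R) hcont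
      (f' := fun t => 3 / 2 * √t * E t + t * √t * (2 * p t * (-(a t * u t) - b t) +
        (a' t * u t ^ 2 + a t * (2 * u t * (p t + d t)))) + 8 * D / t ^ 2) ?_ ?_
    · intro t ht
      rw [interior_Icc] at ht
      have ht' : t ∈ Icc r R := ⟨ht.1.le, ht.2.le⟩
      have ht0 : 0 < t := hr.trans ht.1
      have hu1 := (hu t ht').hasDerivAt (Icc_mem_nhds ht.1 ht.2)
      have hp1 := (hp t ht').hasDerivAt (Icc_mem_nhds ht.1 ht.2)
      have hs : HasDerivAt (fun t : ℝ => t * √t) (3 / 2 * √t) t := by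
        have := (hasDerivAt_id t).mul (Real.hasDerivAt_sqrt ht0.ne')
        convert! this using 1
        field_simp
        simp only [id]
        rw [Real.sq_sqrt ht0.le]; ring
      have hE1 : HasDerivAt E (2 * p t * (-(a t * u t) - b t) +
        (a' t * u t ^ 2 + a t * (2 * u t * (p t + d t)))) t := by
        have := (hp1.pow 2).add ((ha t ht').mul (hu1.pow 2))
        convert! this using 1
        simp
      have hD : HasDerivAt (fun t : ℝ => 8 * D / t) (-(8 * D / t ^ 2)) t := by
        have := (hasDerivAt_inv ht0.ne').const_mul (8 * D)
        convert! this using 1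
        field_simp
      have := (hs.mul hE1).sub hD
      refine HasDerivAt.hasDerivWithinAt ?_
      convert! this using 1
      ring
    · intro t ht
      rw [interior_Icc] at ht
      have ht' : t ∈ Icc r R := ⟨ht.1.le, ht.2.le⟩
      have ht0 : 0 < t := hr.trans ht.1
      have hA := hapos t ht'
      set s := √(a t) with hs
      have hs2 : s ^ 2 = a t := Real.sq_sqrt hA.le
      have hq0 : 0 < √t := Real.sqrt_pos.2 ht0
      -- the three error terms, each bounded by a fraction of the energy
      have e1 : 8 * t * (2 * p t * b t) ≤ E t := by
        have h1 : 8 * t * (2 * p t * b t) ≤ 2 * |p t| * (8 * t * |b t|) := by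
          have := le_abs_self (p t * b t)
          rw [abs_mul] at this
          nlinarith
        have h2 : 2 * |p t| * (8 * t * |b t|) ≤ 2 * |p t| * (s * |u t|) :=
          mul_le_mul_of_nonneg_left (hb t ht') (by positivity)
        have h3 : E t = |p t| ^ 2 + (s * |u t|) ^ 2 := by
          rw [mul_pow, sq_abs, sq_abs, hs2]
        nlinarith [sq_nonneg (|p t| - s * |u t|)]
      have e2 : t * (-(a' t * u t ^ 2)) ≤ 5 / 4 * E t := by
        have h1 : t * (-(a' t)) ≤ 5 / 4 * a t :=
          (mul_le_mul_of_nonneg_left (neg_le_abs _) ht0.le).trans (ha' t ht')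
        have h2 := mul_le_mul_of_nonneg_right h1 (sq_nonneg (u t))
        have h3 := sq_nonneg (p t)
        simp only [hE]
        nlinarith
      have e3 : t * (-(2 * a t * u t * d t)) ≤ 1 / 8 * E t + 8 * t ^ 2 * (a t * d t ^ 2) := by
        have h3 := sq_nonneg (p t)
        have h4 : 0 ≤ a t * (u t / 8 + t * d t) ^ 2 := by positivity
        simp only [hE]
        nlinarith
      have e4 : 8 * t * √t * (t * (a t * d t ^ 2)) ≤ 8 * D / t ^ 2 := by
        have h1 := mul_le_mul_of_nonneg_left (hd t ht') (by positivity : 0 ≤ 8 * t ^ 2)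
        have h2 : 8 * t ^ 2 * (D / t ^ 4) = 8 * D / t ^ 2 := by field_simp
        nlinarith
      have e5 : 0 ≤ √t * (3 / 2 * E t + t * (2 * p t * (-(a t * u t) - b t) +
        (a' t * u t ^ 2 + a t * (2 * u t * (p t + d t)))) + 8 * t ^ 2 * (a t * d t ^ 2)) := by
        refine mul_nonneg hq0.le ?_
        nlinarith
      nlinarith
  have h := hmono (left_mem_Icc.2 hrR) (right_mem_Icc.2 hrR) hrR
  simp only [hW, hE] at h
  by_cases hD : 0 ≤ D
  · have : 0 ≤ 8 * D / R := by have := hr.trans_le hrR; positivity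
    linarith
  · exfalso
    have h1 := hd r (left_mem_Icc.2 hrR)
    have h2 := hapos r (left_mem_Icc.2 hrR)
    have h3 : 0 ≤ a r * d r ^ 2 * √r := by positivity
    have h4 : D / r ^ 4 < 0 := div_neg_of_neg_of_pos (not_le.1 hD) (by positivity)
    linarith

/-! ### Taylor estimates and the inverse profile -/

lemma abs_sub_le_mul_of_deriv {F F' : ℝ → ℝ} {s : Set ℝ} (hs : Convex ℝ s) {C : ℝ}
    (hF : ∀ x ∈ s, HasDerivAt F (F' x) x) (hC : ∀ x ∈ s, |F' x| ≤ C) {x y : ℝ}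
    (hx : x ∈ s) (hy : y ∈ s) : |F y - F x| ≤ C * |y - x| :=
  hs.norm_image_sub_le_of_norm_hasDerivWithin_le (fun x hx => (hF x hx).hasDerivWithinAt) hC hx hy

/-- A first-order Taylor estimate for a function whose derivative is Lipschitz at `x`. -/
lemma abs_taylor_le {F F' : ℝ → ℝ} {s : Set ℝ} (hs : Convex ℝ s) {A x y : ℝ}
    (hF : ∀ z ∈ s, HasDerivAt F (F' z) z) (hx : x ∈ s) (hy : y ∈ s)
    (hA : ∀ z ∈ s, |F' z - F' x| ≤ A * |z - x|) :
    |F y - F x - F' x * (y - x)| ≤ A * |y - x| ^ 2 := by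
  have hsub : uIcc x y ⊆ s := hs.ordConnected.uIcc_subset hx hy
  by_cases hA0 : 0 ≤ A
  · have h := abs_sub_le_mul_of_deriv (F := fun z => F z - F' x * z) (F' := fun z => F' z - F' x)
      (convex_uIcc x y) (C := A * |y - x|) (fun z hz => by
        have := (hF z (hsub hz)).sub ((hasDerivAt_id z).const_mul (F' x))
        simpa using! this) (fun z hz => (hA z (hsub hz)).trans (by
          gcongr 1
          have := abs_sub_left_of_mem_uIcc hz
          simpa using this)) left_mem_uIcc right_mem_uIcc
    rw [show F y - F x - F' x * (y - x) = F y - F' x * y - (F x - F' x * x) by ring]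
    exact h.trans_eq (by ring)
  · by_cases hxy : y = x
    · subst hxy; simp
    · have h1 := hA y hy
      have h2 : 0 < |y - x| := abs_pos.2 (sub_ne_zero.2 hxy)
      nlinarith [abs_nonneg (F' y - F' x)]

lemma abs_sub_le_mul_log {F F1 : ℝ → ℝ} {s t C : ℝ} (hs : 0 < s) (hst : s ≤ t)
    (hF : ∀ x ∈ Icc s t, HasDerivAt F (F1 x / x) x) (hC : ∀ x ∈ Icc s t, |F1 x| ≤ C) :
    |F t - F s| ≤ C * (Real.log t - Real.log s) := by
  have key : ∀ e : ℝ, |e| = 1 → e * (F t - F s) ≤ C * (Real.log t - Real.log s) := by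
    intro e he
    have hmono : MonotoneOn (fun x => C * Real.log x - e * F x) (Icc s t) := by
      have hd : ∀ x ∈ Icc s t, HasDerivAt (fun x => C * Real.log x - e * F x)
          (C * x⁻¹ - e * (F1 x / x)) x := fun x hx =>
        ((Real.hasDerivAt_log (hs.trans_le hx.1).ne').const_mul C).sub ((hF x hx).const_mul e)
      refine monotoneOn_of_hasDerivWithinAt_nonneg (convex_Icc s t)
        (fun x hx => (hd x hx).continuousAt.continuousWithinAt)
        (fun x hx => (hd x (interior_subset hx)).hasDerivWithinAt) fun x hx => ?_
      have hx' := interior_subset hx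
      have hx0 : 0 < x := hs.trans_le hx'.1
      have h1 : e * F1 x ≤ C := by
        refine (le_abs_self _).trans ?_
        rw [abs_mul, he, one_mul]
        exact hC x hx'
      have : C * x⁻¹ - e * (F1 x / x) = (C - e * F1 x) * x⁻¹ := by field_simp
      rw [this]
      exact mul_nonneg (by linarith) (by positivity)
    have := hmono (left_mem_Icc.2 hst) (right_mem_Icc.2 hst) hst
    simp only at this
    linarith
  have h1 := key 1 (by simp)
  have h2 := key (-1) (by simp)
  rw [abs_le]
  constructor <;> linarith

/-- Landau's interpolation in the logarithmic variable: a function with a limit and a bounded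
second logarithmic derivative has a first logarithmic derivative tending to zero. -/
lemma tendsto_zero_of_tendsto_of_bounded {h h1 h2 : ℝ → ℝ} {ℓ M r : ℝ} (hr : 0 < r)
    (hh : ∀ t > r, HasDerivAt h (h1 t / t) t) (hh1 : ∀ t > r, HasDerivAt h1 (h2 t / t) t)
    (hM : ∀ t > r, |h2 t| ≤ M) (hlim : Tendsto h atTop (𝓝 ℓ)) : Tendsto h1 atTop (𝓝 0) := by
  have hM0 : 0 ≤ M := (abs_nonneg _).trans (hM (r + 1) (by linarith))
  rw [Metric.tendsto_atTop] at hlim ⊢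
  intro e he
  -- the step `δ` of the difference quotient
  set δ : ℝ := e / (2 * (M + 1)) with hδ
  have hδ0 : 0 < δ := by positivity
  obtain ⟨N, hN⟩ := hlim (e * δ / (8 * (1 + δ))) (by positivity)
  refine ⟨max N (r + 1), fun t ht => ?_⟩
  have htN : N ≤ t := (le_max_left _ _).trans ht
  have htr : r < t := by linarith [(le_max_right N (r + 1)).trans ht]
  have ht0 : 0 < t := hr.trans htr
  have htt : t < t * (1 + δ) := by nlinarith
  obtain ⟨ξ, hξ, hξe⟩ := exists_hasDerivAt_eq_slope h (fun x => h1 x / x) htt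
    (fun x hx => (hh x (htr.trans_le hx.1)).continuousAt.continuousWithinAt)
    (fun x hx => hh x (htr.trans hx.1))
  have hξ0 : 0 < ξ := ht0.trans hξ.1
  have hA : |h (t * (1 + δ)) - h t| < 2 * (e * δ / (8 * (1 + δ))) := by
    have a1 := hN t htN
    have a2 := hN (t * (1 + δ)) (htN.trans htt.le)
    rw [Real.dist_eq] at a1 a2
    have : h (t * (1 + δ)) - h t = (h (t * (1 + δ)) - ℓ) - (h t - ℓ) := by ring
    rw [this]
    exact (abs_sub _ _).trans_lt (by linarith)
  have hB : |h1 ξ| ≤ e / 4 := by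
    have e1 : h1 ξ = ξ / (t * δ) * (h (t * (1 + δ)) - h t) := by
      have : t * (1 + δ) - t = t * δ := by ring
      rw [this] at hξe
      field_simp at hξe ⊢
      linarith
    have e2 : ξ / (t * δ) ≤ (1 + δ) / δ := by
      rw [div_le_div_iff₀ (by positivity) hδ0]
      nlinarith [hξ.2]
    rw [e1, abs_mul, abs_of_pos (by positivity)]
    calc _ ≤ (1 + δ) / δ * (2 * (e * δ / (8 * (1 + δ)))) := by gcongr
      _ = e / 4 := by field_simp; norm_num
  have hC : |h1 ξ - h1 t| ≤ M * δ := by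
    refine (abs_sub_le_mul_log ht0 hξ.1.le (fun x hx => hh1 x (htr.trans_le hx.1))
      (fun x hx => hM x (htr.trans_le hx.1))).trans ?_
    gcongr
    rw [← Real.log_div hξ0.ne' ht0.ne']
    refine (Real.log_le_sub_one_of_pos (by positivity)).trans ?_
    rw [sub_le_iff_le_add, div_le_iff₀ ht0]
    linarith [hξ.2]
  have hD : M * δ ≤ e / 2 := by
    rw [hδ, mul_div_assoc', div_le_div_iff₀ (by positivity) (by norm_num)]
    nlinarith
  rw [Real.dist_eq, sub_zero]
  have : h1 t = h1 ξ - (h1 ξ - h1 t) := by ring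
  rw [this]
  exact (abs_sub _ _).trans_lt (by linarith)

/-- The inverse `G` of the exponent `g = log f`, seen in the variable `ρ = g(s)`: here
`φ = G' = 1 / g'(G)` and `h = H(G)`, and `h1`, `h2`, `h3` are the iterated derivatives of `h` under
`ρ * d/dρ`. The identity `φ' = -h φ / ρ` is the definition of `H`, and `f (G ρ) = exp ρ` is the
definition of `G`. All the properties are required on `(r, ∞)`. -/
structure InverseProfile (f G φ h h1 h2 h3 : ℝ → ℝ) (c M r : ℝ) : Prop where
  exp_one_le : Real.exp 1 ≤ r
  c_pos : 0 < c
  hasDerivAt_G : ∀ t > r, HasDerivAt G (φ t) t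
  φ_pos : ∀ t > r, 0 < φ t
  hasDerivAt_φ : ∀ t > r, HasDerivAt φ (-(h t * φ t / t)) t
  hasDerivAt_h : ∀ t > r, HasDerivAt h (h1 t / t) t
  hasDerivAt_h1 : ∀ t > r, HasDerivAt h1 (h2 t / t) t
  hasDerivAt_h2 : ∀ t > r, HasDerivAt h2 (h3 t / t) t
  le_h : ∀ t > r, c ≤ h t
  h_le : ∀ t > r, h t ≤ M
  h1_le : ∀ t > r, |h1 t| ≤ M
  h2_le : ∀ t > r, |h2 t| ≤ M
  h3_le : ∀ t > r, |h3 t| ≤ M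
  h1_tendsto : Tendsto h1 atTop (𝓝 0)
  G_tendsto : Tendsto G atTop atTop
  f_G : ∀ t > r, f (G t) = Real.exp t
  hasDerivAt_f : ∀ t > r, HasDerivAt f (Real.exp t / φ t) (G t)

namespace InverseProfile

variable {f G φ h h1 h2 h3 : ℝ → ℝ} {c M r : ℝ}

section Basic

lemma pos_of_lt (P : InverseProfile f G φ h h1 h2 h3 c M r) {t : ℝ} (ht : r < t) : 0 < t :=
  (Real.exp_pos 1).trans (P.exp_one_le.trans_lt ht)

lemma one_le_log (P : InverseProfile f G φ h h1 h2 h3 c M r) {t : ℝ} (ht : r < t) :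
    1 ≤ Real.log t := by
  rw [Real.le_log_iff_exp_le (P.pos_of_lt ht)]
  exact P.exp_one_le.trans ht.le

lemma h_pos (P : InverseProfile f G φ h h1 h2 h3 c M r) {t : ℝ} (ht : r < t) : 0 < h t :=
  P.c_pos.trans_le (P.le_h t ht)

lemma M_pos (P : InverseProfile f G φ h h1 h2 h3 c M r) : 0 < M :=
  (P.h_pos (by linarith : r < r + 1)).trans_le (P.h_le _ (by linarith))

/-- The part of `(r, ∞)` comparable with `t`. -/
lemma lt_of_mem_Icc {t x : ℝ} (ht : 2 * r < t) (hx : x ∈ Icc (t / 2) (3 * t / 2)) : r < x := by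
  linarith [hx.1]

lemma abs_log_φ_sub_le (P : InverseProfile f G φ h h1 h2 h3 c M r) {s t : ℝ} (hs : r < s)
    (hst : s ≤ t) : |Real.log (φ t) - Real.log (φ s)| ≤ M * (Real.log t - Real.log s) := by
  refine abs_sub_le_mul_log (F := fun x => Real.log (φ x)) (F1 := fun x => - h x)
    (P.pos_of_lt hs) hst (fun x hx => ?_) (fun x hx => ?_)
  · have hx' := hs.trans_le hx.1
    have := (P.hasDerivAt_φ x hx').log (P.φ_pos x hx').ne'
    convert! this using 1
    have := (P.φ_pos x hx').ne'
    field_simp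
  · have hx' := hs.trans_le hx.1
    rw [abs_neg, abs_of_pos (P.h_pos hx')]
    exact P.h_le x hx'

lemma φ_le_of_mem (P : InverseProfile f G φ h h1 h2 h3 c M r) {t : ℝ} (ht : 2 * r < t) {x y : ℝ}
    (hx : x ∈ Icc (t / 2) (3 * t / 2)) (hy : y ∈ Icc (t / 2) (3 * t / 2)) :
    φ x ≤ Real.exp (2 * M) * φ y := by
  have key : ∀ s ∈ Icc (t / 2) (3 * t / 2), ∀ u ∈ Icc (t / 2) (3 * t / 2), s ≤ u →
      |Real.log (φ u) - Real.log (φ s)| ≤ 2 * M := by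
    intro s hs u hu hsu
    have hsr := lt_of_mem_Icc ht hs
    have hs0 := P.pos_of_lt hsr
    have hu0 := hs0.trans_le hsu
    have hl : Real.log u - Real.log s ≤ 2 := by
      rw [← Real.log_div hu0.ne' hs0.ne']
      refine (Real.log_le_sub_one_of_pos (by positivity)).trans ?_
      rw [sub_le_iff_le_add, div_le_iff₀ hs0]
      linarith [hs.1, hu.2]
    have := P.abs_log_φ_sub_le hsr hsu
    nlinarith [P.M_pos]
  have h3 : Real.log (φ x) ≤ 2 * M + Real.log (φ y) := by
    rcases le_total x y with hxy | hxy
    · linarith [(abs_le.1 (key x hx y hy hxy)).1]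
    · linarith [(abs_le.1 (key y hy x hx hxy)).2]
  rw [← Real.exp_log (P.φ_pos x (lt_of_mem_Icc ht hx)),
    ← Real.exp_log (P.φ_pos y (lt_of_mem_Icc ht hy)), ← Real.exp_add]
  simpa [Real.log_exp] using h3

lemma self_mem_Icc {t : ℝ} (ht : 0 < t) : t ∈ Icc (t / 2) (3 * t / 2) :=
  ⟨by linarith, by linarith⟩

lemma abs_φ_sub_le (P : InverseProfile f G φ h h1 h2 h3 c M r) {t : ℝ} (ht : 2 * r < t) {x : ℝ}
    (hx : x ∈ Icc (t / 2) (3 * t / 2)) :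
    |φ x - φ t| ≤ 2 * M * Real.exp (2 * M) * φ t / t * |x - t| := by
  have hr0 : 0 < r := (Real.exp_pos 1).trans_le P.exp_one_le
  have ht0 : 0 < t := by linarith
  have htm := self_mem_Icc ht0
  refine abs_sub_le_mul_of_deriv (convex_Icc (t / 2) (3 * t / 2))
    (fun z hz => P.hasDerivAt_φ z (lt_of_mem_Icc ht hz)) (fun z hz => ?_) htm hx
  have hzr := lt_of_mem_Icc ht hz
  have hz0 := P.pos_of_lt hzr
  have hφ := P.φ_pos z hzr
  have hh := P.h_pos hzr
  have hφt := P.φ_pos t (by linarith)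
  rw [abs_neg, abs_of_pos (by positivity), div_le_div_iff₀ hz0 ht0]
  calc h z * φ z * t ≤ M * (Real.exp (2 * M) * φ t) * (2 * z) := by
        have := P.φ_le_of_mem ht hz htm
        have := P.h_le z hzr
        have := P.M_pos
        gcongr
        linarith [hz.1]
    _ = _ := by ring

lemma hasDerivAt_φ' (P : InverseProfile f G φ h h1 h2 h3 c M r) {t : ℝ} (ht : r < t) :
    HasDerivAt (fun t => -(h t * φ t / t)) (φ t * (h t + h t ^ 2 - h1 t) / t ^ 2) t := by
  have ht0 := (P.pos_of_lt ht).ne'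
  have := (((P.hasDerivAt_h t ht).mul (P.hasDerivAt_φ t ht)).div (hasDerivAt_id t) ht0).neg
  convert! this using 1
  simp only [Pi.mul_apply, id]
  field_simp
  ring

lemma abs_φ_taylor_le (P : InverseProfile f G φ h h1 h2 h3 c M r) {t : ℝ} (ht : 2 * r < t) {x : ℝ}
    (hx : x ∈ Icc (t / 2) (3 * t / 2)) :
    |φ x - φ t + h t * φ t / t * (x - t)| ≤
      4 * (2 * M + M ^ 2) * Real.exp (2 * M) * φ t / t ^ 2 * |x - t| ^ 2 := by
  have hr0 : 0 < r := (Real.exp_pos 1).trans_le P.exp_one_le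
  have ht0 : 0 < t := by linarith
  have htm := self_mem_Icc ht0
  have := abs_taylor_le (F := φ) (F' := fun t => -(h t * φ t / t))
    (A := 4 * (2 * M + M ^ 2) * Real.exp (2 * M) * φ t / t ^ 2)
    (convex_Icc (t / 2) (3 * t / 2))
    (fun z hz => P.hasDerivAt_φ z (lt_of_mem_Icc ht hz)) htm hx (fun z hz => by
      refine abs_sub_le_mul_of_deriv (convex_Icc (t / 2) (3 * t / 2))
        (fun z hz => P.hasDerivAt_φ' (lt_of_mem_Icc ht hz)) (fun z hz => ?_) htm hz
      have hzr := lt_of_mem_Icc ht hz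
      have hz0 := P.pos_of_lt hzr
      have hφ := P.φ_pos z hzr
      have hh := P.h_pos hzr
      have hM := P.M_pos
      have hφt := P.φ_pos t (by linarith)
      rw [abs_div, abs_mul, abs_of_pos hφ, abs_of_pos (by positivity : 0 < z ^ 2),
        div_le_div_iff₀ (by positivity) (by positivity)]
      have b1 : |h z + h z ^ 2 - h1 z| ≤ 2 * M + M ^ 2 := by
        have a1 := P.h_le z hzr
        have a2 := abs_le.1 (P.h1_le z hzr)
        rw [abs_le]
        constructor <;> nlinarith [sq_nonneg (h z)]
      have b2 := P.φ_le_of_mem ht hz htm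
      have b3 : t ≤ 2 * z := by linarith [hz.1]
      calc _ ≤ (Real.exp (2 * M) * φ t) * (2 * M + M ^ 2) * (2 * z) ^ 2 := by gcongr
        _ = _ := by ring)
  convert this using 2
  ring

lemma abs_G_taylor_le (P : InverseProfile f G φ h h1 h2 h3 c M r) {t : ℝ} (ht : 2 * r < t) {x : ℝ}
    (hx : x ∈ Icc (t / 2) (3 * t / 2)) :
    |G x - G t - φ t * (x - t)| ≤ 2 * M * Real.exp (2 * M) * φ t / t * |x - t| ^ 2 := by
  have hr0 : 0 < r := (Real.exp_pos 1).trans_le P.exp_one_le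
  have ht0 : 0 < t := by linarith
  exact abs_taylor_le (convex_Icc (t / 2) (3 * t / 2))
    (fun z hz => P.hasDerivAt_G z (lt_of_mem_Icc ht hz)) (self_mem_Icc ht0) hx
    (fun z hz => P.abs_φ_sub_le ht hz)

end Basic

end InverseProfile

/-! ### The corrected approximate solution -/

/-- The quantity `log (4 h φ / t)`: it makes `(1/4) exp (phase t)` equal to `h φ / t = -G''`, so
that shifting the argument of `G` by it balances the equation to leading order. -/
noncomputable def phase (φ h : ℝ → ℝ) (t : ℝ) : ℝ :=
  Real.log 4 + Real.log (h t) + Real.log (φ t) - Real.log t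

/-- The leading approximation to the solution, `mainPart` in terms of the inverse profile. -/
noncomputable def leadingPart (G φ h : ℝ → ℝ) (t : ℝ) : ℝ := G t + φ t * phase φ h t

lemma abs_log_one_add_le {x : ℝ} (hx : |x| ≤ 1 / 2) : |Real.log (1 + x)| ≤ 2 * |x| := by
  have h1 := abs_le.1 hx
  have h0 : 0 < 1 + x := by linarith
  have h2 := Real.log_le_sub_one_of_pos h0
  have h3 := Real.one_sub_inv_le_log_of_pos h0
  have h4 : 1 - (1 + x)⁻¹ = x / (1 + x) := by field_simp; ring
  rw [h4] at h3
  have h5 : |x / (1 + x)| ≤ 2 * |x| := by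
    rw [abs_div, abs_of_pos h0, div_le_iff₀ h0]
    nlinarith [abs_nonneg x]
  have h6 := (abs_le.1 h5).1
  have h7 := le_abs_self x
  have h8 := abs_nonneg x
  rw [abs_le]
  constructor <;> linarith

lemma eventually_const_mul_log_le (K : ℝ) {e : ℝ} (he : 0 < e) :
    ∀ᶠ t : ℝ in atTop, K * Real.log t ≤ e * t := by
  have := (Real.isLittleO_log_id_atTop.const_mul_left K).def he
  filter_upwards [this, eventually_gt_atTop 0] with t ht ht0
  simp only [Real.norm_eq_abs, id, abs_of_pos ht0] at ht
  exact (le_abs_self _).trans ht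

namespace InverseProfile

variable {f G φ h h1 h2 h3 : ℝ → ℝ} {c M r : ℝ}

section Approx

lemma exp_phase (P : InverseProfile f G φ h h1 h2 h3 c M r) {t : ℝ} (ht : r < t) :
    Real.exp (phase φ h t) = 4 * (h t * φ t / t) := by
  unfold phase
  rw [Real.exp_sub, Real.exp_add, Real.exp_add, Real.exp_log (by norm_num),
    Real.exp_log (P.h_pos ht), Real.exp_log (P.φ_pos t ht), Real.exp_log (P.pos_of_lt ht)]
  ring

lemma hasDerivAt_phase (P : InverseProfile f G φ h h1 h2 h3 c M r) {t : ℝ} (ht : r < t) :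
    HasDerivAt (phase φ h) ((h1 t / h t - h t - 1) / t) t := by
  have hh := (P.h_pos ht).ne'
  have hφ := (P.φ_pos t ht).ne'
  have ht0 := (P.pos_of_lt ht).ne'
  have := ((((P.hasDerivAt_h t ht).log hh).const_add (Real.log 4)).add
    ((P.hasDerivAt_φ t ht).log hφ)).sub (Real.hasDerivAt_log ht0)
  convert! this using 1
  field_simp
  ring

lemma isBigO_h (P : InverseProfile f G φ h h1 h2 h3 c M r) :
    h =O[atTop] (1 : ℝ → ℝ) := by
  refine IsBigO.of_bound M ?_
  filter_upwards [eventually_gt_atTop r] with t ht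
  simpa [abs_of_pos (P.h_pos ht)] using P.h_le t ht

lemma isBigO_inv_h (P : InverseProfile f G φ h h1 h2 h3 c M r) :
    (fun t => (h t)⁻¹) =O[atTop] (1 : ℝ → ℝ) := by
  refine IsBigO.of_bound c⁻¹ ?_
  filter_upwards [eventually_gt_atTop r] with t ht
  simp only [norm_inv, Real.norm_eq_abs, abs_of_pos (P.h_pos ht), Pi.one_apply, abs_one, mul_one]
  exact inv_anti₀ P.c_pos (P.le_h t ht)

lemma isBigO_one_log : (1 : ℝ → ℝ) =O[atTop] Real.log := by
  refine IsBigO.of_bound 1 ?_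
  filter_upwards [eventually_ge_atTop (Real.exp 1)] with t ht
  have : 1 ≤ Real.log t := (Real.le_log_iff_exp_le ((Real.exp_pos 1).trans_le ht)).2 ht
  simpa using this.trans (le_abs_self _)

lemma isBigO_phase (P : InverseProfile f G φ h h1 h2 h3 c M r) :
    phase φ h =O[atTop] Real.log := by
  set K := M / c + M + 1 with hK
  have hM := P.M_pos
  have hc := P.c_pos
  refine IsBigO.of_bound (K + |phase φ h (r + 1)|) ?_
  filter_upwards [eventually_ge_atTop (r + 1)] with t ht
  have hrt : r < t := by linarith
  have hl := P.one_le_log hrt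
  have key := abs_sub_le_mul_log (F := phase φ h) (F1 := fun t => h1 t / h t - h t - 1) (C := K)
    (P.pos_of_lt (lt_add_one r)) ht
    (fun x hx => P.hasDerivAt_phase (by linarith [hx.1])) (fun x hx => by
      have hx' : r < x := by linarith [hx.1]
      have hh := P.h_pos hx'
      have e1 : |h1 x / h x| ≤ M / c := by
        rw [abs_div, abs_of_pos hh]
        exact div_le_div₀ hM.le (P.h1_le x hx') hc (P.le_h x hx')
      have e2 := P.h_le x hx'
      have e3 := abs_le.1 e1
      rw [abs_le]
      constructor <;> linarith)
  rw [Real.norm_eq_abs, Real.norm_eq_abs, abs_of_pos (by linarith : 0 < Real.log t)]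
  have h3 : |phase φ h t| ≤ |phase φ h t - phase φ h (r + 1)| + |phase φ h (r + 1)| := by
    have := abs_add_le (phase φ h t - phase φ h (r + 1)) (phase φ h (r + 1))
    simpa using this
  have hK0 : 0 < K := by positivity
  have h4 : |phase φ h (r + 1)| ≤ |phase φ h (r + 1)| * Real.log t :=
    le_mul_of_one_le_right (abs_nonneg _) hl
  have h5 : 0 ≤ Real.log (r + 1) := zero_le_one.trans (P.one_le_log (lt_add_one r))
  nlinarith

lemma hasDerivAt_leadingPart (P : InverseProfile f G φ h h1 h2 h3 c M r) {t : ℝ} (ht : r < t) :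
    HasDerivAt (leadingPart G φ h)
      (φ t * (1 + (h1 t / h t - h t - 1 - h t * phase φ h t) / t)) t := by
  have ht0 := (P.pos_of_lt ht).ne'
  have hh := (P.h_pos ht).ne'
  have := (P.hasDerivAt_G t ht).add ((P.hasDerivAt_φ t ht).mul (P.hasDerivAt_phase ht))
  convert! this using 1
  field_simp
  ring

/-- The second derivative of the leading approximation is `-(h φ / t) (1 + B / t)`, where `B` and
its logarithmic derivative are of logarithmic size. -/
lemma exists_deriv_leadingPart (P : InverseProfile f G φ h h1 h2 h3 c M r) :
    ∃ B B1 : ℝ → ℝ, B =O[atTop] Real.log ∧ B1 =O[atTop] Real.log ∧ ∀ t > r,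
      HasDerivAt B (B1 t / t) t ∧
      HasDerivAt (fun t => φ t * (1 + (h1 t / h t - h t - 1 - h t * phase φ h t) / t))
        (-(h t * φ t / t * (1 + B t / t))) t := by
  set i : ℝ → ℝ := fun t => (h t)⁻¹ with hi
  set ψ : ℝ → ℝ := phase φ h with hψ
  -- the iterated logarithmic derivatives of the phase
  set ψ1 : ℝ → ℝ := fun t => h1 t * i t - h t - 1 with hψ1
  set ψ2 : ℝ → ℝ := fun t => h2 t * i t - h1 t * h1 t * (i t * i t) - h1 t with hψ2
  set ψ3 : ℝ → ℝ := fun t => h3 t * i t - 3 * (h1 t * h2 t * (i t * i t))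
    + 2 * (h1 t * h1 t * h1 t * (i t * i t * i t)) - h2 t with hψ3
  set a : ℝ → ℝ := fun t => h1 t - h t - h t * h t with ha
  set a1 : ℝ → ℝ := fun t => h2 t - h1 t - 2 * (h t * h1 t) with ha1
  have one_mul_one : ∀ u v : ℝ → ℝ, u =O[atTop] (1 : ℝ → ℝ) → v =O[atTop] (1 : ℝ → ℝ) →
      (fun t => u t * v t) =O[atTop] (1 : ℝ → ℝ) := fun u v hu hv => by
    have := hu.mul hv
    simp only [Pi.one_apply, one_mul] at this
    exact this
  have one_mul_log : ∀ u v : ℝ → ℝ, u =O[atTop] (1 : ℝ → ℝ) → v =O[atTop] Real.log →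
      (fun t => u t * v t) =O[atTop] Real.log := fun u v hu hv => by
    have := hu.mul hv
    simp only [Pi.one_apply, one_mul] at this
    exact this
  have bdd : ∀ u : ℝ → ℝ, (∀ t > r, |u t| ≤ M) → u =O[atTop] (1 : ℝ → ℝ) := fun u hu => by
    refine IsBigO.of_bound M ?_
    filter_upwards [eventually_gt_atTop r] with t ht
    simpa using hu t ht
  have Oh := P.isBigO_h
  have Oi : i =O[atTop] (1 : ℝ → ℝ) := P.isBigO_inv_h
  have Oh1 := bdd h1 P.h1_le
  have Oh2 := bdd h2 P.h2_le
  have Oh3 := bdd h3 P.h3_le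
  have Oone : (fun _ : ℝ => (1 : ℝ)) =O[atTop] (1 : ℝ → ℝ) := isBigO_refl _ _
  have Oii := one_mul_one i i Oi Oi
  have Oψ : ψ =O[atTop] Real.log := P.isBigO_phase
  have Oψ1 : ψ1 =O[atTop] (1 : ℝ → ℝ) := ((one_mul_one _ _ Oh1 Oi).sub Oh).sub Oone
  have Oψ2 : ψ2 =O[atTop] (1 : ℝ → ℝ) :=
    ((one_mul_one _ _ Oh2 Oi).sub (one_mul_one _ _ (one_mul_one _ _ Oh1 Oh1) Oii)).sub Oh1
  have Oψ3 : ψ3 =O[atTop] (1 : ℝ → ℝ) :=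
    (((one_mul_one _ _ Oh3 Oi).sub
      ((one_mul_one _ _ (one_mul_one _ _ Oh1 Oh2) Oii).const_mul_left 3)).add
      ((one_mul_one _ _ (one_mul_one _ _ (one_mul_one _ _ Oh1 Oh1) Oh1)
        (one_mul_one _ _ Oii Oi)).const_mul_left 2)).sub Oh2
  have Oa : a =O[atTop] (1 : ℝ → ℝ) := (Oh1.sub Oh).sub (one_mul_one _ _ Oh Oh)
  have Oa1 : a1 =O[atTop] (1 : ℝ → ℝ) :=
    (Oh2.sub Oh1).sub ((one_mul_one _ _ Oh Oh1).const_mul_left 2)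
  have Oin : (fun t => a t * ψ t - ψ2 t + ψ1 t) =O[atTop] Real.log :=
    ((one_mul_log _ _ Oa Oψ).sub (Oψ2.trans isBigO_one_log)).add (Oψ1.trans isBigO_one_log)
  refine ⟨fun t => 2 * ψ1 t + i t * (a t * ψ t - ψ2 t + ψ1 t),
    fun t => 2 * ψ2 t + (-(h1 t * (i t * i t)) * (a t * ψ t - ψ2 t + ψ1 t) +
      i t * (a1 t * ψ t + a t * ψ1 t - ψ3 t + ψ2 t)), ?_, ?_, fun t ht => ?_⟩
  · exact ((Oψ1.trans isBigO_one_log).const_mul_left 2).add (one_mul_log _ _ Oi Oin)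
  · refine ((Oψ2.trans isBigO_one_log).const_mul_left 2).add
      ((one_mul_log _ _ (one_mul_one _ _ Oh1 Oii).neg_left Oin).add (one_mul_log _ _ Oi ?_))
    exact (((one_mul_log _ _ Oa1 Oψ).add ((one_mul_one _ _ Oa Oψ1).trans isBigO_one_log)).sub
      (Oψ3.trans isBigO_one_log)).add (Oψ2.trans isBigO_one_log)
  · have ht0 := (P.pos_of_lt ht).ne'
    have hh := (P.h_pos ht).ne'
    have dh := P.hasDerivAt_h t ht
    have dh1 := P.hasDerivAt_h1 t ht
    have dh2 := P.hasDerivAt_h2 t ht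
    have dφ := P.hasDerivAt_φ t ht
    have dψ := P.hasDerivAt_phase ht
    have di : HasDerivAt i (-(h1 t * (i t * i t)) / t) t := by
      have := dh.inv hh
      convert! this using 1
      simp only [hi]
      field_simp
    have dψ1 : HasDerivAt ψ1 (ψ2 t / t) t := by
      have := ((dh1.mul di).sub dh).sub_const 1
      convert! this using 1
      simp only [hψ2]
      field_simp
      ring
    have dψ2 : HasDerivAt ψ2 (ψ3 t / t) t := by
      have := ((dh2.mul di).sub ((dh1.mul dh1).mul (di.mul di))).sub dh1
      convert! this using 1
      simp only [hψ3, Pi.mul_apply]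
      field_simp
      ring
    have da : HasDerivAt a (a1 t / t) t := by
      have := (dh1.sub dh).sub (dh.mul dh)
      convert! this using 1
      simp only [ha1]
      field_simp
      ring
    have dψ' : HasDerivAt ψ (ψ1 t / t) t := by
      convert dψ using 1
      simp only [hψ1, hi, div_eq_mul_inv]
    refine ⟨?_, ?_⟩
    · have := (dψ1.const_mul 2).add (di.mul (((da.mul dψ').sub dψ2).add dψ1))
      convert! this using 1
      simp only [Pi.add_apply, Pi.sub_apply, Pi.mul_apply]
      field_simp
    · have := dφ.mul ((((dψ1.sub (dh.mul dψ')).div (hasDerivAt_id t) ht0)).const_add 1)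
      have e : HasDerivAt (fun t => φ t * (1 + (ψ1 t - h t * ψ t) / t))
        (-(h t * φ t / t * (1 + (2 * ψ1 t + i t * (a t * ψ t - ψ2 t + ψ1 t)) / t))) t := by
        convert! this using 1
        simp only [id, Pi.sub_apply, Pi.mul_apply, Pi.div_apply, ha, hi]
        field_simp
        ring
      convert! e using 1

lemma correction_sum_le {K l t y B : ℝ} (hK : 0 ≤ K) (ht : 0 ≤ t) (hy : 0 ≤ y) (hl : 1 ≤ l) :
    B * y / t * (3 * K * l) ^ 2 + y * (2 * (K * l / t)) ≤
      (2 * K + 9 * B * K ^ 2) * y * l ^ 2 / t := by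
  have h : 2 * K * l * (y / t) ≤ 2 * K * l ^ 2 * (y / t) := by
    have : l ≤ l ^ 2 := by nlinarith
    gcongr
  linear_combination h

lemma correction_deriv_sum_le {A K l t y M B e : ℝ} (he : 0 ≤ e) (hB : 0 ≤ B) (hK : 0 ≤ K)
    (hM : 0 ≤ M) (hy : 0 ≤ y) (hl : 1 ≤ l) :
    A * y / t ^ 2 * (3 * K * l) ^ 2 + M * y / t * (2 * (K * l / t))
      + K / t * (B * y / t * (3 * K * l)) + e * y * (4 * K * l / t ^ 2) ≤
    (9 * A * K ^ 2 + 2 * M * K + 3 * B * K ^ 2 + 4 * e * K) * y * l ^ 2 / t ^ 2 := by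
  have h : (2 * M * K + 3 * B * K ^ 2 + 4 * e * K) * l * (y / t ^ 2) ≤
      (2 * M * K + 3 * B * K ^ 2 + 4 * e * K) * l ^ 2 * (y / t ^ 2) := by
    have : l ≤ l ^ 2 := by nlinarith
    gcongr
  linear_combination h

set_option maxHeartbeats 1000000 in
/-- One step of the iteration `Y ↦ G (t + log (-4 Y''))` from the leading part `m` gives a corrected
approximation `Y`, for which `m'' = -(1/4) f(Y) exp(-t)` holds exactly and which is close to `m`
together with its first derivative. -/
lemma exists_corrected (P : InverseProfile f G φ h h1 h2 h3 c M r) :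
    ∃ (m' Y Y' : ℝ → ℝ) (C R : ℝ), 0 < C ∧ r ≤ R ∧ ∀ t > R,
      HasDerivAt (leadingPart G φ h) (m' t) t ∧
      HasDerivAt m' (-(1 / 4 * f (Y t) * Real.exp (-t))) t ∧
      HasDerivAt Y (Y' t) t ∧
      |Y t - leadingPart G φ h t| ≤ C * φ t * Real.log t ^ 2 / t ∧
      |m' t - Y' t| ≤ C * φ t * Real.log t ^ 2 / t ^ 2 := by
  obtain ⟨B, B1, OB, OB1, hB⟩ := P.exists_deriv_leadingPart
  have hM := P.M_pos
  have hc := P.c_pos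
  obtain ⟨K1, hK1, e1⟩ := OB.exists_pos
  obtain ⟨K2, hK2, e2⟩ := OB1.exists_pos
  obtain ⟨K3, hK3, e3⟩ := P.isBigO_phase.exists_pos
  set K := K1 + K2 + K3 + (M / c + M + 1) with hK
  have hMc : 0 < M / c := by positivity
  have hK0 : 0 < K := by positivity
  rw [IsBigOWith] at e1 e2 e3
  set C1 := 2 * M * Real.exp (2 * M) with hC1
  set C3 := 4 * (2 * M + M ^ 2) * Real.exp (2 * M) with hC3
  have hC10 : 0 < C1 := by positivity
  have hev : ∀ᶠ t in atTop, r < t ∧ 2 * r < t ∧ |B t| ≤ K * Real.log t ∧ |B1 t| ≤ K * Real.log t ∧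
      |phase φ h t| ≤ K * Real.log t ∧ 6 * K * Real.log t ≤ 1 * t := by
    filter_upwards [e1, e2, e3, eventually_gt_atTop r, eventually_gt_atTop (2 * r),
      eventually_const_mul_log_le (6 * K) one_pos] with t f1 f2 f3 ht ht2 f4
    have hl := P.one_le_log ht
    simp only [Real.norm_eq_abs, abs_of_pos (by linarith : 0 < Real.log t)] at f1 f2 f3
    refine ⟨ht, ht2, f1.trans ?_, f2.trans ?_, f3.trans ?_, f4⟩
    all_goals
      gcongr
      linarith
  obtain ⟨R, hR⟩ := eventually_atTop.1 hev
  set θ : ℝ → ℝ := fun t => t + phase φ h t + Real.log (1 + B t / t) with hθ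
  set lam' : ℝ → ℝ := fun t => ((B1 t - B t) / t ^ 2) / (1 + B t / t) with hlam
  obtain ⟨Ca, hCa⟩ : ∃ Ca, Ca = 2 * K + 9 * C1 * K ^ 2 := ⟨_, rfl⟩
  obtain ⟨Cb, hCb⟩ : ∃ Cb, Cb = 9 * C3 * K ^ 2 + 2 * M * K + 3 * C1 * K ^ 2 +
    4 * Real.exp (2 * M) * K := ⟨_, rfl⟩
  have hCa0 : 0 < Ca := by rw [hCa]; positivity
  have hCb0 : 0 < Cb := by rw [hCb]; positivity
  refine ⟨fun t => φ t * (1 + (h1 t / h t - h t - 1 - h t * phase φ h t) / t), fun t => G (θ t),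
    fun t => φ (θ t) * (1 + (h1 t / h t - h t - 1) / t + lam' t),
    Ca + Cb, max R r, by rw [hCa, hCb]; positivity, le_max_right _ _, fun t ht => ?_⟩
  obtain ⟨htr, ht2, b1, b2, b3, b4⟩ := hR t ((le_max_left _ _).trans ht.le)
  obtain ⟨dB, dm⟩ := hB t htr
  have ht0 := P.pos_of_lt htr
  have hl := P.one_le_log htr
  have hφ := P.φ_pos t htr
  have hh := P.h_pos htr
  set l := Real.log t with hldef
  set ψ := phase φ h t with hψ
  set ψ1 := h1 t / h t - h t - 1 with hψ1
  have bψ1 : |ψ1| ≤ K := by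
    have f1 : |h1 t / h t| ≤ M / c := by
      rw [abs_div, abs_of_pos hh]
      exact div_le_div₀ hM.le (P.h1_le t htr) hc (P.le_h t htr)
    have f2 := P.h_le t htr
    have f3 := abs_le.1 f1
    rw [abs_le]
    constructor <;> linarith
  have bBt : |B t / t| ≤ K * l / t := by
    rw [abs_div, abs_of_pos ht0]
    gcongr
  have bBh : |B t / t| ≤ 1 / 2 := by
    refine bBt.trans ?_
    rw [div_le_iff₀ ht0]
    have : 0 ≤ K * l := by positivity
    linarith
  have hQ : 1 / 2 ≤ 1 + B t / t := by linarith [(abs_le.1 bBh).1]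
  have bL : |Real.log (1 + B t / t)| ≤ 2 * (K * l / t) :=
    (abs_log_one_add_le bBh).trans (by gcongr)
  have ht1 : 1 ≤ t := by
    have := P.exp_one_le
    have := Real.add_one_le_exp 1
    linarith
  have bL' : 2 * (K * l / t) ≤ 2 * (K * l) := by
    gcongr
    exact div_le_self (by positivity) ht1
  have bθ : |θ t - t| ≤ 3 * K * l := by
    have : θ t - t = ψ + Real.log (1 + B t / t) := by simp only [hθ]; ring
    rw [this]
    refine (abs_add_le _ _).trans ?_
    linarith
  have hθm : θ t ∈ Icc (t / 2) (3 * t / 2) := by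
    have := abs_le.1 bθ
    constructor <;> linarith
  have hθr := lt_of_mem_Icc ht2 hθm
  have dL : HasDerivAt (fun t => Real.log (1 + B t / t)) (lam' t) t := by
    have := ((dB.div (hasDerivAt_id t) ht0.ne').const_add 1).log (by simp only [Pi.div_apply, id]; linarith)
    convert! this using 1
    simp only [hlam, id, Pi.div_apply]
    congr 1
    field_simp
  have dθ : HasDerivAt θ (1 + ψ1 / t + lam' t) t :=
    ((hasDerivAt_id t).add (P.hasDerivAt_phase htr)).add dL
  refine ⟨P.hasDerivAt_leadingPart htr, ?_, ?_, ?_, ?_⟩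
  · convert! dm using 1
    rw [P.f_G _ hθr]
    simp only [hθ]
    rw [Real.exp_add, Real.exp_add, Real.exp_log (by linarith), P.exp_phase htr, Real.exp_neg]
    field_simp
  · exact (P.hasDerivAt_G _ hθr).comp t dθ
  · have f1 := P.abs_G_taylor_le ht2 hθm
    have f2 : G (θ t) - leadingPart G φ h t =
        (G (θ t) - G t - φ t * (θ t - t)) + φ t * Real.log (1 + B t / t) := by
      simp only [leadingPart, hθ]; ring
    rw [f2]
    refine (abs_add_le _ _).trans ?_
    rw [abs_mul, abs_of_pos hφ]
    calc _ ≤ C1 * φ t / t * (3 * K * l) ^ 2 + φ t * (2 * (K * l / t)) := by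
          refine add_le_add (f1.trans ?_) (by gcongr)
          gcongr
      _ ≤ Ca * φ t * l ^ 2 / t := by
          rw [hCa]
          exact correction_sum_le hK0.le ht0.le hφ.le hl
      _ ≤ _ := by
          gcongr
          linarith
  · have f1 := P.abs_φ_taylor_le ht2 hθm
    have f2 := P.abs_φ_sub_le ht2 hθm
    have f3 := P.φ_le_of_mem ht2 hθm (self_mem_Icc ht0)
    have f4 : |lam' t| ≤ 4 * K * l / t ^ 2 := by
      simp only [hlam]
      rw [abs_div, abs_div, abs_of_pos (by linarith : 0 < 1 + B t / t),
        abs_of_pos (by positivity : 0 < t ^ 2), div_le_iff₀ (by linarith)]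
      have g1 : |B1 t - B t| ≤ 2 * K * l := (abs_sub _ _).trans (by linarith)
      calc _ ≤ 2 * K * l / t ^ 2 := by gcongr
        _ = 4 * K * l / t ^ 2 * (1 / 2) := by ring
        _ ≤ _ := by gcongr
    have hφθ := P.φ_pos _ hθr
    have f5 : φ t * (1 + (ψ1 - h t * ψ) / t) - φ (θ t) * (1 + ψ1 / t + lam' t) =
        -((φ (θ t) - φ t + h t * φ t / t * (θ t - t)) - h t * φ t / t * Real.log (1 + B t / t)
          + ψ1 / t * (φ (θ t) - φ t) + φ (θ t) * lam' t) := by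
      simp only [hθ]; ring
    rw [f5, abs_neg]
    have g2 : |h t * φ t / t * Real.log (1 + B t / t)| ≤ M * φ t / t * (2 * (K * l / t)) := by
      rw [abs_mul, abs_of_pos (by positivity)]
      have := P.h_le t htr
      gcongr
    have g3 : |ψ1 / t * (φ (θ t) - φ t)| ≤ K / t * (C1 * φ t / t * (3 * K * l)) := by
      rw [abs_mul, abs_div, abs_of_pos ht0]
      refine mul_le_mul (by gcongr) (f2.trans (by gcongr)) (abs_nonneg _) (by positivity)
    have g4 : |φ (θ t) * lam' t| ≤ Real.exp (2 * M) * φ t * (4 * K * l / t ^ 2) := by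
      rw [abs_mul, abs_of_pos hφθ]
      gcongr
    have g1 : |φ (θ t) - φ t + h t * φ t / t * (θ t - t)| ≤ C3 * φ t / t ^ 2 * (3 * K * l) ^ 2 :=
      f1.trans (by gcongr)
    calc _ ≤ C3 * φ t / t ^ 2 * (3 * K * l) ^ 2 + M * φ t / t * (2 * (K * l / t))
          + K / t * (C1 * φ t / t * (3 * K * l)) +
          Real.exp (2 * M) * φ t * (4 * K * l / t ^ 2) := by
          refine (abs_add_le _ _).trans (add_le_add ?_ g4)
          refine (abs_add_le _ _).trans (add_le_add ?_ g3)
          exact (abs_sub _ _).trans (add_le_add g1 g2)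
      _ ≤ Cb * φ t * l ^ 2 / t ^ 2 := by
          rw [hCb]
          exact correction_deriv_sum_le (Real.exp_pos _).le hC10.le hK0.le hM.le hφ.le hl
      _ ≤ _ := by
          gcongr
          linarith

end Approx

end InverseProfile

/-! ### Linearization around the leading part and uniqueness near infinity -/

lemma tendsto_log_sq_div_sqrt : Tendsto (fun t : ℝ => Real.log t ^ 2 / √t) atTop (𝓝 0) := by
  have := (isLittleO_log_rpow_rpow_atTop (2 : ℝ) (s := 1 / 2) (by norm_num)).tendsto_div_nhds_zero
  refine this.congr' ?_
  filter_upwards [eventually_ge_atTop 0] with t ht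
  rw [Real.sqrt_eq_rpow, Real.rpow_two]

namespace InverseProfile

variable {f G φ h h1 h2 h3 : ℝ → ℝ} {c M r : ℝ}

section Linearization

/-- In the tube of width `τ φ / √t` around the leading part, the derivative of
`y ↦ (1/4) f(y) exp(-t)` differs from `h / t` by at most `δ / t ^ (3/2)`. -/
lemma exists_deriv_nonlinearity_bound (P : InverseProfile f G φ h h1 h2 h3 c M r) {δ : ℝ}
    (hδ : 0 < δ) : ∃ τ > 0, ∃ R, ∀ t > R, ∀ y, |y - leadingPart G φ h t| ≤ τ * φ t / √t →
      ∃ q, HasDerivAt f q y ∧ |1 / 4 * q * Real.exp (-t) - h t / t| ≤ δ / (t * √t) := by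
  have hM := P.M_pos
  obtain ⟨K, hK, e1⟩ := P.isBigO_phase.exists_pos
  rw [IsBigOWith] at e1
  set e2 := Real.exp (2 * M) with he2
  have he20 : 0 < e2 := Real.exp_pos _
  set C1 := 2 * M * e2 with hC1
  set τ : ℝ := δ / (8 * M * e2 ^ 2) with hτ
  have hτ0 : 0 < τ := by positivity
  -- the smallness conditions on `t` reduce to `log t ^ 2 = o(√t)`
  have hlog := tendsto_log_sq_div_sqrt
  have hsq : Tendsto (fun t : ℝ => √t) atTop atTop := Real.tendsto_sqrt_atTop
  have hev : ∀ᶠ t in atTop, 2 * r < t ∧ r < t ∧ |phase φ h t| ≤ K * Real.log t ∧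
      4 * K * Real.log t ≤ 1 * t ∧ 4 ≤ t ∧ C1 * K ^ 2 * (Real.log t ^ 2 / √t) ≤ τ ∧
      M * (e2 * (C1 * (K + 1))) * (Real.log t ^ 2 / √t) ≤ δ / 2 ∧
      2 * e2 * τ ≤ √t := by
    have l1 := (hlog.const_mul (C1 * K ^ 2)).eventually_le_const (by simpa using hτ0)
    have l2 := (hlog.const_mul (M * (e2 * (C1 * (K + 1))))).eventually_le_const
      (by rw [mul_zero]; exact half_pos hδ)
    filter_upwards [e1, eventually_gt_atTop (2 * r), eventually_gt_atTop r,
      eventually_const_mul_log_le (4 * K) one_pos, eventually_ge_atTop 4, l1, l2,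
      hsq.eventually_ge_atTop (2 * e2 * τ)] with t a1 a2 a3 a4 a5 a6 a7 a8
    have hl := P.one_le_log a3
    simp only [Real.norm_eq_abs, abs_of_pos (by linarith : 0 < Real.log t)] at a1
    exact ⟨a2, a3, a1, a4, a5, a6, a7, a8⟩
  obtain ⟨R, hR⟩ := eventually_atTop.1 hev
  refine ⟨τ, hτ0, R, fun t ht y hy => ?_⟩
  obtain ⟨ht2, htr, b1, b2, ht4, b3, b4, b5⟩ := hR t ht.le
  have ht0 := P.pos_of_lt htr
  have hφ := P.φ_pos t htr
  have hl := P.one_le_log htr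
  have hs0 : 0 < √t := Real.sqrt_pos.2 ht0
  have hss : √t * √t = t := Real.mul_self_sqrt ht0.le
  set l := Real.log t with hl_def
  set s := √t with hs
  set ψ := phase φ h t with hψ
  set k : ℝ := 2 * e2 * τ / s with hk
  have hk0 : 0 < k := by positivity
  have hk1 : k ≤ 1 := by rw [hk, div_le_one hs0]; exact b5
  have hψl := abs_le.1 b1
  have hmem : ∀ x, |x - (t + ψ)| ≤ k → x ∈ Icc (t / 2) (3 * t / 2) := fun x hx => by
    have := abs_le.1 hx
    constructor <;> linarith
  have hmid := hmem (t + ψ) (by simpa using hk0.le)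
  -- `G (t + ψ)` is close to the leading part
  have c1 : |G (t + ψ) - leadingPart G φ h t| ≤ τ * φ t / s := by
    have := P.abs_G_taylor_le ht2 hmid
    have e : G (t + ψ) - G t - φ t * (t + ψ - t) = G (t + ψ) - leadingPart G φ h t := by
      simp only [leadingPart]; ring
    rw [e] at this
    refine this.trans ?_
    have e' : |t + ψ - t| ≤ K * l := by simpa using b1
    calc _ ≤ C1 * φ t / t * (K * l) ^ 2 := by gcongr
      _ = (C1 * K ^ 2 * (l ^ 2 / s)) * φ t / s := by
          rw [← hss]; field_simp
      _ ≤ τ * φ t / s := by gcongr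
  have c2 : |y - G (t + ψ)| ≤ 2 * τ * φ t / s := by
    have : y - G (t + ψ) = (y - leadingPart G φ h t) - (G (t + ψ) - leadingPart G φ h t) := by ring
    rw [this]
    refine (abs_sub _ _).trans ((add_le_add hy c1).trans_eq ?_)
    ring
  have c3 : ∀ x₁ x₂, |x₁ - (t + ψ)| ≤ k → |x₂ - (t + ψ)| ≤ k → x₁ ≤ x₂ →
      e2⁻¹ * φ t * (x₂ - x₁) ≤ G x₂ - G x₁ := by
    intro x₁ x₂ hx₁ hx₂ hx
    have hd : ∀ x ∈ Icc (t / 2) (3 * t / 2), HasDerivAt G (φ x) x := fun x hx =>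
      P.hasDerivAt_G x (lt_of_mem_Icc ht2 hx)
    refine (convex_Icc (t / 2) (3 * t / 2)).mul_sub_le_image_sub_of_le_deriv
      (fun x hx => (hd x hx).continuousAt.continuousWithinAt)
      (fun x hx => (hd x (interior_subset hx)).differentiableAt.differentiableWithinAt)
      (fun x hx => ?_) x₁ (hmem _ hx₁) x₂ (hmem _ hx₂) hx
    rw [(hd x (interior_subset hx)).deriv, inv_mul_le_iff₀ he20]
    exact P.φ_le_of_mem ht2 (self_mem_Icc ht0) (interior_subset hx)
  have hke : e2⁻¹ * φ t * k = 2 * τ * φ t / s := by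
    rw [hk]; field_simp
  obtain ⟨ζ, hζ, hζy⟩ : ∃ ζ ∈ Icc (t + ψ - k) (t + ψ + k), G ζ = y := by
    have g1 := c3 (t + ψ - k) (t + ψ) (by simp [abs_of_pos hk0]) (by simpa using hk0.le)
      (by linarith)
    have g2 := c3 (t + ψ) (t + ψ + k) (by simpa using hk0.le) (by simp [abs_of_pos hk0])
      (by linarith)
    rw [sub_sub_cancel, hke] at g1
    rw [add_sub_cancel_left, hke] at g2
    have g3 := abs_le.1 c2
    refine intermediate_value_Icc (by linarith) (fun x hx => ?_) ⟨by linarith, by linarith⟩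
    refine (P.hasDerivAt_G x (lt_of_mem_Icc ht2 (hmem x ?_))).continuousAt.continuousWithinAt
    rw [abs_le]
    constructor <;> linarith [hx.1, hx.2]
  have hζk : |ζ - (t + ψ)| ≤ k := by
    rw [abs_le]
    constructor <;> linarith [hζ.1, hζ.2]
  have hζm := hmem ζ hζk
  have hζr := lt_of_mem_Icc ht2 hζm
  have hφζ := P.φ_pos ζ hζr
  refine ⟨Real.exp ζ / φ ζ, hζy ▸ P.hasDerivAt_f ζ hζr, ?_⟩
  have hh := P.h_pos htr
  have d1 : 1 / 4 * (Real.exp ζ / φ ζ) * Real.exp (-t) - h t / t =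
      h t / t * ((Real.exp (ζ - (t + ψ)) - 1) * (φ t / φ ζ) + (φ t - φ ζ) / φ ζ) := by
    have : Real.exp ζ = Real.exp (ζ - (t + ψ)) * Real.exp ψ * Real.exp t := by
      rw [← Real.exp_add, ← Real.exp_add]; congr 1; ring
    rw [this, P.exp_phase htr, Real.exp_neg]
    field_simp
    ring
  have d2 : |Real.exp (ζ - (t + ψ)) - 1| ≤ 2 * k := by
    have := Real.abs_exp_sub_one_le (x := ζ - (t + ψ)) (hζk.trans hk1)
    linarith
  have d3 : φ t / φ ζ ≤ e2 := by
    rw [div_le_iff₀ hφζ]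
    exact P.φ_le_of_mem ht2 (self_mem_Icc ht0) hζm
  have d4 : |(φ t - φ ζ) / φ ζ| ≤ e2 * (C1 * (K + 1)) * l / t := by
    rw [abs_div, abs_of_pos hφζ, abs_sub_comm]
    have g1 : |ζ - t| ≤ (K + 1) * l := by
      have : ζ - t = (ζ - (t + ψ)) + ψ := by ring
      rw [this]
      refine (abs_add_le _ _).trans ?_
      linarith
    calc |φ ζ - φ t| / φ ζ ≤ (C1 * φ t / t * ((K + 1) * l)) / φ ζ := by
          gcongr
          exact (P.abs_φ_sub_le ht2 hζm).trans (by gcongr)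
      _ = φ t / φ ζ * (C1 * (K + 1) * l / t) := by ring
      _ ≤ e2 * (C1 * (K + 1) * l / t) := by gcongr
      _ = _ := by ring
  rw [d1, abs_mul, abs_of_pos (by positivity : 0 < h t / t)]
  have d5 : |(Real.exp (ζ - (t + ψ)) - 1) * (φ t / φ ζ) + (φ t - φ ζ) / φ ζ| ≤
      2 * k * e2 + e2 * (C1 * (K + 1)) * l / t := by
    refine (abs_add_le _ _).trans (add_le_add ?_ d4)
    rw [abs_mul, abs_of_pos (by positivity : 0 < φ t / φ ζ)]
    gcongr
  have d6 : M * (e2 * (C1 * (K + 1))) * l / s ≤ δ / 2 := by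
    refine le_trans ?_ b4
    rw [mul_div_assoc]
    gcongr
    nlinarith
  calc _ ≤ M / t * (2 * k * e2 + e2 * (C1 * (K + 1)) * l / t) := by
        have := P.h_le t htr
        gcongr
    _ = (4 * M * e2 ^ 2 * τ + M * (e2 * (C1 * (K + 1))) * l / s) / (t * s) := by
        rw [hk]
        have : t = s * s := hss.symm
        rw [this]
        field_simp
        ring
    _ ≤ (δ / 2 + δ / 2) / (t * s) := by
        gcongr
        rw [hτ]
        refine le_of_eq ?_
        field_simp
        norm_num
    _ = _ := by ring

/-- The integrated form: `y ↦ (1/4) f(y) exp(-t)` is linear with slope `h / t` in the tube, up to a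
Lipschitz error of relative size `δ / √t`. -/
lemma exists_nonlinearity_bound (P : InverseProfile f G φ h h1 h2 h3 c M r) {δ : ℝ}
    (hδ : 0 < δ) : ∃ τ > 0, ∃ R, ∀ t > R,
      (∀ x, |x - leadingPart G φ h t| ≤ τ * φ t / √t → ContinuousAt f x) ∧
      ∀ x y, |x - leadingPart G φ h t| ≤ τ * φ t / √t →
        |y - leadingPart G φ h t| ≤ τ * φ t / √t →
        |1 / 4 * f x * Real.exp (-t) - 1 / 4 * f y * Real.exp (-t) - h t / t * (x - y)| ≤
          δ / (t * √t) * |x - y| := by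
  obtain ⟨τ, hτ, R, hR⟩ := P.exists_deriv_nonlinearity_bound hδ
  refine ⟨τ, hτ, R, fun t ht => ⟨fun x hx => ?_, fun x y hx hy => ?_⟩⟩
  · obtain ⟨q, hq, -⟩ := hR t ht x hx
    exact hq.continuousAt
  set m := leadingPart G φ h t
  have hball : ∀ z, z ∈ Metric.closedBall m (τ * φ t / √t) ↔ |z - m| ≤ τ * φ t / √t := fun z => by
    rw [Metric.mem_closedBall, Real.dist_eq]
  choose! q hq hq' using hR t ht
  have := abs_sub_le_mul_of_deriv (convex_closedBall m (τ * φ t / √t))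
    (F := fun z => 1 / 4 * f z * Real.exp (-t) - h t / t * z)
    (F' := fun z => 1 / 4 * q z * Real.exp (-t) - h t / t) (C := δ / (t * √t))
    (fun z hz => by
      have := (((hq z ((hball z).1 hz)).const_mul (1 / 4)).mul_const (Real.exp (-t))).sub
        ((hasDerivAt_id z).const_mul (h t / t))
      simpa using! this)
    (fun z hz => hq' z ((hball z).1 hz)) ((hball y).2 hy) ((hball x).2 hx)
  convert this using 2
  ring

/-- The frequency `h / t` of the linearized equation satisfies the hypotheses of the backward
energy estimate. -/
lemma eventually_frequency (P : InverseProfile f G φ h h1 h2 h3 c M r) :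
    ∃ R ≥ r, ∀ t > R, HasDerivAt (fun t => h t / t) ((h1 t - h t) / t ^ 2) t ∧ 0 < h t / t ∧
      t * |(h1 t - h t) / t ^ 2| ≤ 5 / 4 * (h t / t) ∧
      ∀ b u : ℝ, |b| ≤ √c / 8 / (t * √t) * |u| → 8 * t * |b| ≤ √(h t / t) * |u| := by
  have hev : ∀ᶠ t in atTop, r < t ∧ |h1 t| < c / 4 := by
    have h := P.h1_tendsto.abs
    rw [abs_zero] at h
    filter_upwards [eventually_gt_atTop r, h.eventually_lt_const
      (by have := P.c_pos; positivity : 0 < c / 4)] with t a b using ⟨a, b⟩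
  obtain ⟨R, hR⟩ := eventually_atTop.1 hev
  refine ⟨max R r, le_max_right _ _, fun t ht => ?_⟩
  obtain ⟨htr, hh1⟩ := hR t ((le_max_left _ _).trans ht.le)
  have ht0 := P.pos_of_lt htr
  have hh := P.h_pos htr
  have hc := P.le_h t htr
  have hc0 := P.c_pos
  refine ⟨?_, by positivity, ?_, fun b u hb => ?_⟩
  · have := (P.hasDerivAt_h t htr).div (hasDerivAt_id t) ht0.ne'
    convert! this using 1
    simp only [id]
    field_simp
  · rw [abs_div, abs_of_pos (by positivity : 0 < t ^ 2)]
    have h3 : |h1 t - h t| ≤ 5 / 4 * h t := by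
      have := abs_sub (h1 t) (h t)
      rw [abs_of_pos hh] at this
      linarith
    calc _ = |h1 t - h t| / t := by field_simp
      _ ≤ 5 / 4 * h t / t := by gcongr
      _ = _ := by ring
  · have hs0 : 0 < √t := Real.sqrt_pos.2 ht0
    rw [Real.sqrt_div hh.le]
    calc 8 * t * |b| ≤ 8 * t * (√c / 8 / (t * √t) * |u|) := by gcongr
      _ = √c / √t * |u| := by field_simp
      _ ≤ _ := by gcongr

lemma φ_le_of_le (P : InverseProfile f G φ h h1 h2 h3 c M r) {s t : ℝ} (hs : r < s) (hst : s ≤ t) :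
    φ t ≤ φ s := by
  have hd : ∀ x ∈ Ici s, HasDerivAt φ (-(h x * φ x / x)) x := fun x hx =>
    P.hasDerivAt_φ x (hs.trans_le hx)
  refine antitoneOn_of_hasDerivWithinAt_nonpos (convex_Ici s)
    (fun x hx => (hd x hx).continuousAt.continuousWithinAt)
    (fun x hx => (hd x (interior_subset hx)).hasDerivWithinAt) (fun x hx => ?_)
    self_mem_Ici hst hst
  have hx' : r < x := hs.trans_le (interior_subset hx)
  have := P.h_pos hx'
  have := P.φ_pos x hx'
  have := P.pos_of_lt hx'
  simp only [Left.neg_nonpos_iff]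
  positivity

/-- Two solutions in the tube `o(φ / √t)` around the leading part agree near infinity: their
difference has an energy that grows at most like `t ^ (-3/2)` backwards, but is `O(t ^ (-2))`
along a sequence. -/
lemma eventually_eq_of_isLittleO (P : InverseProfile f G φ h h1 h2 h3 c M r)
    {Λ : ℝ} {y₁ z₁ y₂ z₂ : ℝ → ℝ}
    (hy₁ : ∀ t > Λ, HasDerivAt y₁ (z₁ t) t)
    (hz₁ : ∀ t > Λ, HasDerivAt z₁ (-(1 / 4 * f (y₁ t) * Real.exp (-t))) t)
    (hy₂ : ∀ t > Λ, HasDerivAt y₂ (z₂ t) t)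
    (hz₂ : ∀ t > Λ, HasDerivAt z₂ (-(1 / 4 * f (y₂ t) * Real.exp (-t))) t)
    (ho₁ : (fun t => y₁ t - leadingPart G φ h t) =o[atTop] (fun t => φ t / √t))
    (ho₂ : (fun t => y₂ t - leadingPart G φ h t) =o[atTop] (fun t => φ t / √t)) :
    ∀ᶠ t in atTop, y₁ t = y₂ t := by
  have hc := P.c_pos
  have hM := P.M_pos
  obtain ⟨τ, hτ, R₁, hR₁⟩ := P.exists_nonlinearity_bound (δ := √c / 8)
    (by have := Real.sqrt_pos.2 hc; positivity)
  obtain ⟨R₂, hR₂r, hR₂⟩ := P.eventually_frequency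
  have hev : ∀ᶠ t in atTop, |y₁ t - leadingPart G φ h t| ≤ τ * φ t / √t ∧
      |y₂ t - leadingPart G φ h t| ≤ τ * φ t / √t := by
    filter_upwards [ho₁.def hτ, ho₂.def hτ, eventually_gt_atTop r] with t a b htr
    have ht0 := P.pos_of_lt htr
    have hφ := P.φ_pos t htr
    have : 0 < φ t / √t := by have := Real.sqrt_pos.2 ht0; positivity
    simp only [Real.norm_eq_abs, abs_of_pos this] at a b
    rw [mul_div_assoc]
    exact ⟨a, b⟩
  obtain ⟨R₃, hR₃⟩ := eventually_atTop.1 hev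
  set R := max (max R₁ R₂) (max R₃ Λ) with hR
  have hRR₁ : R₁ ≤ R := (le_max_left _ _).trans (le_max_left _ _)
  have hRR₂ : R₂ ≤ R := (le_max_right _ _).trans (le_max_left _ _)
  have hRR₃ : R₃ ≤ R := (le_max_left _ _).trans (le_max_right _ _)
  have hRΛ : Λ ≤ R := (le_max_right _ _).trans (le_max_right _ _)
  set v : ℝ → ℝ := fun t => y₁ t - y₂ t with hv
  set p : ℝ → ℝ := fun t => z₁ t - z₂ t with hp
  have hvd : ∀ t > R, HasDerivAt v (p t) t := fun t ht =>
    (hy₁ t (hRΛ.trans_lt ht)).sub (hy₂ t (hRΛ.trans_lt ht))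
  set b : ℝ → ℝ := fun t => 1 / 4 * f (y₁ t) * Real.exp (-t) - 1 / 4 * f (y₂ t) * Real.exp (-t)
    - h t / t * (y₁ t - y₂ t) with hb
  have hpd : ∀ t > R, HasDerivAt p (-(h t / t * v t) - b t) t := fun t ht => by
    have := (hz₁ t (hRΛ.trans_lt ht)).sub (hz₂ t (hRΛ.trans_lt ht))
    convert! this using 1
    simp only [hb, hv]
    ring
  -- the tube gives `v = O(1 / √t)`
  set C := 2 * τ * φ (R + 1) with hC
  have hC0 : 0 < C := by
    have := P.φ_pos (R + 1) (by linarith)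
    positivity
  have hvC : ∀ t ≥ R + 1, |v t| ≤ C / √t := fun t ht => by
    obtain ⟨a1, a2⟩ := hR₃ t (by linarith)
    have a3 := P.φ_le_of_le (by linarith : r < R + 1) ht
    have : v t = (y₁ t - leadingPart G φ h t) - (y₂ t - leadingPart G φ h t) := by
      simp only [hv]; ring
    rw [this]
    calc _ ≤ τ * φ t / √t + τ * φ t / √t := (abs_sub _ _).trans (add_le_add a1 a2)
      _ = 2 * τ * φ t / √t := by ring
      _ ≤ _ := by rw [hC]; gcongr
  filter_upwards [eventually_gt_atTop (R + 1)] with t ht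
  have htr : r < t := by linarith
  have ht0 := P.pos_of_lt htr
  by_contra hne
  set E₀ := t * √t * (p t ^ 2 + h t / t * v t ^ 2) with hE₀
  have hE₀pos : 0 < E₀ := by
    have h1 := P.h_pos htr
    have h2 : 0 < v t ^ 2 := by positivity
    have h3 := Real.sqrt_pos.2 ht0
    positivity
  -- a large time where the energy is small
  obtain ⟨S, hS1, hS2, hS3⟩ : ∃ S, t ≤ S ∧ 1 ≤ S ∧ (16 + M) * C ^ 2 / √S < E₀ := by
    have : Tendsto (fun S : ℝ => (16 + M) * C ^ 2 / √S) atTop (𝓝 0) :=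
      Real.tendsto_sqrt_atTop.const_div_atTop _
    obtain ⟨S, hS⟩ := ((eventually_ge_atTop t).and ((eventually_ge_atTop 1).and
      (this.eventually_lt_const hE₀pos))).exists
    exact ⟨S, hS⟩
  have hS0 : 0 < S := by linarith
  have hsS : 0 < √S := Real.sqrt_pos.2 hS0
  have hsS2 : √S * √S = S := Real.mul_self_sqrt hS0.le
  have hsS1 : √S ≤ S := by
    have : 1 ≤ √S := Real.one_le_sqrt.2 hS2
    nlinarith
  obtain ⟨ξ, hξ, hξe⟩ := exists_hasDerivAt_eq_slope v p (by linarith : S < S + √S)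
    (fun x hx => (hvd x (by linarith [hx.1])).continuousAt.continuousWithinAt)
    (fun x hx => hvd x (by linarith [hx.1]))
  rw [add_sub_cancel_left] at hξe
  have hξ0 : 0 < ξ := by linarith [hξ.1]
  have hsξ2 : √ξ * √ξ = ξ := Real.mul_self_sqrt hξ0.le
  have hpξ : |p ξ| ≤ 4 * C / ξ := by
    have a1 := hvC S (by linarith)
    have a2 := hvC (S + √S) (by linarith)
    have a3 : C / √(S + √S) ≤ C / √S := by gcongr; linarith
    rw [hξe, abs_div, abs_of_pos hsS, div_le_div_iff₀ hsS hξ0]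
    calc _ ≤ (C / √S + C / √S) * (2 * S) := by
          gcongr
          · exact (abs_sub _ _).trans (by linarith)
          · linarith [hξ.2]
      _ = 4 * C * √S := by nth_rewrite 3 [← hsS2]; field_simp; norm_num
  have hEξ : ξ * √ξ * (p ξ ^ 2 + h ξ / ξ * v ξ ^ 2) ≤ (16 + M) * C ^ 2 / √ξ := by
    have a1 : p ξ ^ 2 ≤ (4 * C / ξ) ^ 2 := by rw [← sq_abs]; gcongr
    have a2 : v ξ ^ 2 ≤ (C / √ξ) ^ 2 := by
      rw [← sq_abs]
      gcongr
      exact hvC ξ (by linarith [hξ.1])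
    have a3 := P.h_le ξ (by linarith [hξ.1])
    have a4 := P.h_pos (by linarith [hξ.1] : r < ξ)
    calc _ ≤ ξ * √ξ * ((4 * C / ξ) ^ 2 + M / ξ * (C / √ξ) ^ 2) := by gcongr
      _ = _ := by
          have : ξ = √ξ * √ξ := hsξ2.symm
          generalize √ξ = x at *
          subst this
          field_simp
          ring
  have hEξ' : (16 + M) * C ^ 2 / √ξ ≤ (16 + M) * C ^ 2 / √S := by
    gcongr
    exact hξ.1.le
  have key := energy_backward (r := t) (R := ξ) (D := 0) ht0 (by linarith [hξ.1])
    (u := v) (p := p) (a := fun t => h t / t) (a' := fun t => (h1 t - h t) / t ^ 2) (b := b)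
    (d := fun _ => 0)
    (fun x hx => by
      simpa using (hvd x (by linarith [hx.1])).hasDerivWithinAt)
    (fun x hx => (hpd x (by linarith [hx.1])).hasDerivWithinAt)
    (fun x hx => (hR₂ x (by linarith [hx.1])).1)
    (fun x hx => (hR₂ x (by linarith [hx.1])).2.1)
    (fun x hx => (hR₂ x (by linarith [hx.1])).2.2.1)
    (fun x hx => (hR₂ x (by linarith [hx.1])).2.2.2 _ _ (by
      obtain ⟨a1, a2⟩ := hR₃ x (by linarith [hx.1])
      exact (hR₁ x (by linarith [hx.1])).2 _ _ a1 a2))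
    (fun x hx => by simp)
  simp only [mul_zero, zero_div, add_zero] at key
  linarith

end Linearization

end InverseProfile

/-! ### Decaying solutions of forced oscillators -/

lemma exists_limit_of_abs_sub_le {x : ℕ → ℝ} {e : ℕ → ℝ} {N : ℕ} (he : Tendsto e atTop (𝓝 0))
    (hx : ∀ n ≥ N, ∀ k ≥ n, |x n - x k| ≤ e n) :
    ∃ y, Tendsto x atTop (𝓝 y) ∧ ∀ n ≥ N, |x n - y| ≤ e n := by
  have hc : CauchySeq x := by
    rw [Metric.cauchySeq_iff']
    intro ε hε
    obtain ⟨n, hn, hn'⟩ := ((eventually_ge_atTop N).and (he.eventually_lt_const hε)).exists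
    refine ⟨n, fun k hk => ?_⟩
    rw [Real.dist_eq, abs_sub_comm]
    exact (hx n hn k hk).trans_lt hn'
  obtain ⟨y, hy⟩ := cauchySeq_tendsto_of_complete hc
  refine ⟨y, hy, fun n hn => ?_⟩
  refine le_of_tendsto ((hy.const_sub (x n)).abs) ?_
  filter_upwards [eventually_ge_atTop n] with k hk using hx n hn k hk

set_option maxHeartbeats 1000000 in
/-- A decaying solution of the forced, weakly nonlinear oscillator `u' = p + d`,
`p' = -a u - B(t, u)` on a half-line. It is the limit of the solutions on `[Λ, n]` with zero data
at `n`: the backward energy estimate bounds them and makes them a uniform Cauchy sequence. The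
forcing `d` is the derivative of `-δ`, and the equation is solved for `u + δ`, so that `d` itself
need not be continuous. -/
lemma exists_decaying_solution {a a' d δ D : ℝ → ℝ} {B : ℝ → ℝ → ℝ} {R c M : ℝ} (hR : 1 ≤ R)
    (hc : 0 < c)
    (ha : ∀ t > R, HasDerivAt a (a' t) t) (hac : ∀ t > R, c / t ≤ a t) (haM : ∀ t > R, a t ≤ M)
    (ha' : ∀ t > R, t * |a' t| ≤ 5 / 4 * a t)
    (hB0 : ∀ t > R, B t 0 = 0)
    (hB : ∀ t > R, ∀ u w, 8 * t * |B t u - B t w| ≤ √(a t) * |u - w|)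
    (hBc : ∀ x, ContinuousOn (fun t => B t (x - δ t)) (Ioi R))
    (hδ : ∀ t > R, HasDerivAt δ (-(d t)) t)
    (hd : ∀ t > R, a t * d t ^ 2 * √t ≤ D t / t ^ 4) (hD : AntitoneOn D (Ioi R)) :
    ∃ u p : ℝ → ℝ, ∃ Λ > R, ∀ t > Λ, HasDerivAt u (p t + d t) t ∧
      HasDerivAt p (-(a t * u t) - B t (u t)) t ∧
      t * √t * (a t * u t ^ 2) ≤ 8 * D t / t := by
  set Λ := R + 1 with hΛ
  have hapos : ∀ t > R, 0 < a t := fun t ht =>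
    (by have := zero_lt_one.trans_le (hR.trans ht.le); positivity : 0 < c / t).trans_le (hac t ht)
  have hM : 0 ≤ M := (hapos Λ (by linarith)).le.trans (haM Λ (by linarith))
  have hBl : ∀ t > R, ∀ u w, |B t u - B t w| ≤ (1 + M) * |u - w| := fun t ht u w => by
    have h1 := hB t ht u w
    have h2 : √(a t) ≤ 1 + M := by
      rw [Real.sqrt_le_left (by linarith)]
      nlinarith [haM t ht]
    have h3 : √(a t) * |u - w| ≤ (1 + M) * |u - w| := by gcongr
    have h4 : 1 * |B t u - B t w| ≤ 8 * t * |B t u - B t w| := by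
      gcongr
      linarith
    linarith
  have hac' : ContinuousOn a (Ioi R) := fun t ht => (ha t ht).continuousAt.continuousWithinAt
  have hδc : ContinuousOn δ (Ioi R) := fun t ht => (hδ t ht).continuousAt.continuousWithinAt
  have hD0 : ∀ t > R, 0 ≤ D t := fun t ht => by
    have h1 := hd t ht
    have h2 := hapos t ht
    have h3 : 0 < t := by linarith
    have h4 : 0 ≤ D t / t ^ 4 := le_trans (by positivity) h1
    by_contra h5
    exact absurd h4 (not_le.2 (div_neg_of_neg_of_pos (not_le.1 h5) (by positivity)))
  -- the approximating terminal value problems, for `v = u + δ`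
  have hsol : ∀ n : ℕ, ∃ v p : ℝ → ℝ, Λ ≤ n → v n = δ n ∧ p n = 0 ∧ ∀ t ∈ Icc Λ n,
      HasDerivWithinAt v (p t) (Icc Λ n) t ∧
      HasDerivWithinAt p (-(a t * (v t - δ t)) - B t (v t - δ t)) (Icc Λ n) t := by
    intro n
    by_cases hn : Λ ≤ n
    · have hsub : Icc Λ (n : ℝ) ⊆ Ioi R := fun t ht => by
        have := ht.1
        simp only [mem_Ioi]
        linarith
      obtain ⟨x, hx0, hx⟩ := exists_solution_Icc_terminal
        (F := fun t x => (x.2, -(a t * (x.1 - δ t)) - B t (x.1 - δ t))) hn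
        (K := ⟨1 + 2 * M, by linarith⟩) (fun t ht => by
          refine LipschitzWith.of_dist_le_mul fun x y => ?_
          rw [Prod.dist_eq, Real.dist_eq, Real.dist_eq]
          have e1 : |x.1 - y.1| ≤ dist x y := by
            rw [← Real.dist_eq]; exact le_max_left _ _
          have e2 : |x.2 - y.2| ≤ dist x y := by
            rw [← Real.dist_eq]; exact le_max_right _ _
          have e0 : 0 ≤ dist x y := dist_nonneg
          have htR := hsub ht
          have e3 := hBl t htR (x.1 - δ t) (y.1 - δ t)
          rw [sub_sub_sub_cancel_right] at e3
          show max _ _ ≤ (1 + 2 * M) * dist x y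
          refine max_le (by nlinarith) ?_
          have e4 : -(a t * (x.1 - δ t)) - B t (x.1 - δ t) - (-(a t * (y.1 - δ t)) -
              B t (y.1 - δ t)) = -(a t * (x.1 - y.1) + (B t (x.1 - δ t) - B t (y.1 - δ t))) := by
            ring
          rw [e4, abs_neg]
          refine (abs_add_le _ _).trans ?_
          rw [abs_mul, abs_of_pos (hapos t htR)]
          have e5 : a t * |x.1 - y.1| ≤ M * |x.1 - y.1| := by
            gcongr
            exact haM t htR
          nlinarith [mul_le_mul_of_nonneg_left e1 hM])
        (fun x => by
          refine ContinuousOn.mono ?_ hsub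
          refine ContinuousOn.prodMk continuousOn_const ?_
          exact (hac'.mul (continuousOn_const.sub hδc)).neg.sub (hBc x.1)) (δ n, 0)
      refine ⟨fun t => (x t).1, fun t => (x t).2, fun _ => ⟨by simp [hx0], by simp [hx0],
        fun t ht => ⟨?_, ?_⟩⟩⟩
      · exact (hasFDerivAt_fst (𝕜 := ℝ) (p := x t)).comp_hasDerivWithinAt t (hx t ht)
      · exact (hasFDerivAt_snd (𝕜 := ℝ) (p := x t)).comp_hasDerivWithinAt t (hx t ht)
    · exact ⟨0, 0, fun h => absurd h hn⟩
  choose v p hvp using hsol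
  -- the energy bound for each approximation
  have hE : ∀ n : ℕ, Λ ≤ n → ∀ t ∈ Icc Λ (n : ℝ),
      t * √t * (p n t ^ 2 + a t * (v n t - δ t) ^ 2) ≤ 8 * D t / t := by
    intro n hn t ht
    obtain ⟨e1, e2, e3⟩ := hvp n hn
    have htR : R < t := by linarith [ht.1]
    have hsub : Icc t (n : ℝ) ⊆ Icc Λ n := Icc_subset_Icc_left ht.1
    have key := energy_backward (r := t) (R := n) (D := D t) (by linarith) ht.2
      (u := fun t => v n t - δ t) (p := p n) (a := a) (a' := a')
      (b := fun t => B t (v n t - δ t)) (d := d)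
      (fun s hs => by
        have := ((e3 s (hsub hs)).1.mono hsub).sub
          (hδ s (by linarith [hs.1])).hasDerivWithinAt
        simpa using! this)
      (fun s hs => (e3 s (hsub hs)).2.mono hsub)
      (fun s hs => ha s (by linarith [hs.1])) (fun s hs => hapos s (by linarith [hs.1]))
      (fun s hs => ha' s (by linarith [hs.1]))
      (fun s hs => by
        have := hB s (by linarith [hs.1]) (v n s - δ s) 0
        rwa [hB0 s (by linarith [hs.1]), sub_zero, sub_zero] at this)
      (fun s hs => by
        refine (hd s (by linarith [hs.1])).trans ?_
        have : 0 < s := by linarith [hs.1]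
        gcongr
        exact hD htR (by simp only [mem_Ioi]; linarith [hs.1]) hs.1)
    simpa [e1, e2] using key
  -- the approximations are uniformly Cauchy
  set K := 8 * D Λ * (1 + 1 / c) with hK
  have hcau : ∀ n : ℕ, Λ ≤ n → ∀ k ≥ n, ∀ t ∈ Icc Λ (n : ℝ),
      |v n t - v k t| ≤ √(K / n) ∧ |p n t - p k t| ≤ √(K / n) := by
    intro n hn k hk t ht
    have hnk : (n : ℝ) ≤ k := by exact_mod_cast hk
    have hk' := hn.trans hnk
    obtain ⟨e1, e2, e3⟩ := hvp n hn
    obtain ⟨-, -, e6⟩ := hvp k hk'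
    have htR : R < t := by linarith [ht.1]
    have ht1 : 1 ≤ t := by linarith
    have hsub : Icc t (n : ℝ) ⊆ Icc Λ n := Icc_subset_Icc_left ht.1
    have hsub' : Icc t (n : ℝ) ⊆ Icc Λ k := Icc_subset_Icc ht.1 hnk
    have key := energy_backward (r := t) (R := n) (D := 0) (by linarith) ht.2
      (u := fun t => v n t - v k t) (p := fun t => p n t - p k t) (a := a) (a' := a')
      (b := fun t => B t (v n t - δ t) - B t (v k t - δ t)) (d := fun _ => 0)
      (fun s hs => by
        simpa using! ((e3 s (hsub hs)).1.mono hsub).sub ((e6 s (hsub' hs)).1.mono hsub'))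
      (fun s hs => by
        have := ((e3 s (hsub hs)).2.mono hsub).sub ((e6 s (hsub' hs)).2.mono hsub')
        convert! this using 1
        ring)
      (fun s hs => ha s (by linarith [hs.1])) (fun s hs => hapos s (by linarith [hs.1]))
      (fun s hs => ha' s (by linarith [hs.1]))
      (fun s hs => by
        have := hB s (by linarith [hs.1]) (v n s - δ s) (v k s - δ s)
        rwa [sub_sub_sub_cancel_right] at this)
      (fun s hs => by simp)
    simp only [mul_zero, zero_div, add_zero] at key
    have f1 := hE k hk' n ⟨hn, hnk⟩
    have f2 : D n ≤ D Λ := hD (by simp [hΛ]) (by simp only [mem_Ioi]; linarith) hn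
    have f3 : t * √t * ((p n t - p k t) ^ 2 + a t * (v n t - v k t) ^ 2) ≤ 8 * D Λ / n := by
      refine key.trans ?_
      rw [e1, e2]
      have : (n : ℝ) * √n * ((0 - p k n) ^ 2 + a n * (δ n - v k n) ^ 2) =
          n * √n * (p k n ^ 2 + a n * (v k n - δ n) ^ 2) := by ring
      rw [this]
      refine f1.trans ?_
      gcongr
    rw [mul_add] at f3
    have hs1 : 1 ≤ √t := Real.one_le_sqrt.2 ht1
    have hat := hapos t htR
    have hct : c ≤ t * a t := by
      have := hac t htR
      rwa [div_le_iff₀ (by linarith), mul_comm] at this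
    have f4 : 0 ≤ t * √t * (p n t - p k t) ^ 2 := by positivity
    have f5 : 0 ≤ t * √t * (a t * (v n t - v k t) ^ 2) := by positivity
    have hDn : 0 ≤ 8 * D Λ / n := by have := hD0 Λ (by linarith); positivity
    have hKn : K / n = 8 * D Λ / n + 1 / c * (8 * D Λ / n) := by rw [hK]; field_simp
    have hcD : 0 ≤ 1 / c * (8 * D Λ / n) := by positivity
    constructor
    · refine Real.abs_le_sqrt ?_
      have g1 : c * (v n t - v k t) ^ 2 ≤ t * √t * (a t * (v n t - v k t) ^ 2) := by
        calc c * (v n t - v k t) ^ 2 ≤ (t * a t * √t) * (v n t - v k t) ^ 2 := by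
              gcongr
              exact hct.trans (le_mul_of_one_le_right (by positivity) hs1)
          _ = _ := by ring
      have g3 : (v n t - v k t) ^ 2 ≤ 1 / c * (8 * D Λ / n) := by
        rw [one_div, ← div_eq_inv_mul, le_div_iff₀ hc]
        linarith
      linarith
    · refine Real.abs_le_sqrt ?_
      have g1 : 1 * (p n t - p k t) ^ 2 ≤ t * √t * (p n t - p k t) ^ 2 := by
        gcongr
        exact one_le_mul_of_one_le_of_one_le ht1 hs1
      linarith
  have he : Tendsto (fun n : ℕ => √(K / n)) atTop (𝓝 0) := by
    have h1 : Tendsto (fun n : ℕ => K / (n : ℝ)) atTop (𝓝 0) := tendsto_const_div_atTop_nhds_zero_nat K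
    have h2 := (Real.continuous_sqrt.tendsto 0).comp h1
    rwa [Real.sqrt_zero] at h2
  have hlim : ∀ t : ℝ, ∃ V Q : ℝ, Λ ≤ t → Tendsto (fun n => v n t) atTop (𝓝 V) ∧
      Tendsto (fun n => p n t) atTop (𝓝 Q) ∧ ∀ n : ℕ, t ≤ n →
        |v n t - V| ≤ √(K / n) ∧ |p n t - Q| ≤ √(K / n) := by
    intro t
    by_cases ht : Λ ≤ t
    · obtain ⟨V, hV, hV'⟩ := exists_limit_of_abs_sub_le (x := fun n => v n t) (N := ⌈t⌉₊) he
        (fun n hn k hk => by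
          have : t ≤ n := Nat.ceil_le.1 hn
          exact (hcau n (ht.trans this) k hk t ⟨ht, this⟩).1)
      obtain ⟨Q, hQ, hQ'⟩ := exists_limit_of_abs_sub_le (x := fun n => p n t) (N := ⌈t⌉₊) he
        (fun n hn k hk => by
          have : t ≤ n := Nat.ceil_le.1 hn
          exact (hcau n (ht.trans this) k hk t ⟨ht, this⟩).2)
      exact ⟨V, Q, fun _ => ⟨hV, hQ, fun n hn =>
        ⟨hV' n (Nat.ceil_le.2 hn), hQ' n (Nat.ceil_le.2 hn)⟩⟩⟩
    · exact ⟨0, 0, fun h => absurd h ht⟩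
  choose V Q hVQ using hlim
  have hunif : ∀ (b : ℝ) (F : ℕ → ℝ → ℝ) (F' : ℝ → ℝ) (C : ℝ),
      (∀ t ∈ Ioo Λ b, ∀ n : ℕ, t ≤ n → |F n t - F' t| ≤ C * √(K / n)) →
      TendstoUniformlyOn F F' atTop (Ioo Λ b) := by
    intro b F F' C hF
    rw [Metric.tendstoUniformlyOn_iff]
    intro ε hε
    have h1 := he.const_mul C
    rw [mul_zero] at h1
    filter_upwards [h1.eventually_lt_const hε, eventually_ge_atTop ⌈b⌉₊] with n hn hnb t ht
    rw [dist_comm, Real.dist_eq]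
    exact (hF t ht n (ht.2.le.trans (Nat.ceil_le.1 hnb))).trans_lt hn
  have hloc : ∀ b : ℝ, ∀ᶠ n : ℕ in atTop, ∀ t ∈ Ioo Λ b, HasDerivAt (v n) (p n t) t ∧
      HasDerivAt (p n) (-(a t * (v n t - δ t)) - B t (v n t - δ t)) t := by
    intro b
    filter_upwards [eventually_ge_atTop ⌈b⌉₊] with n hnb t ht
    have htn : t < n := ht.2.trans_le (Nat.ceil_le.1 hnb)
    obtain ⟨-, -, e3⟩ := hvp n (ht.1.le.trans htn.le)
    have hmem : Icc Λ (n : ℝ) ∈ 𝓝 t := Icc_mem_nhds ht.1 htn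
    obtain ⟨e4, e5⟩ := e3 t ⟨ht.1.le, htn.le⟩
    exact ⟨e4.hasDerivAt hmem, e5.hasDerivAt hmem⟩
  refine ⟨fun t => V t - δ t, Q, Λ, by linarith, fun t ht => ?_⟩
  have htR : R < t := by linarith
  have htm : t ∈ Ioo Λ (t + 1) := ⟨ht, by linarith⟩
  refine ⟨?_, ?_, ?_⟩
  · have hV : HasDerivAt V (Q t) t := by
      refine hasDerivAt_of_tendstoUniformlyOn (f := v) (f' := p) isOpen_Ioo
        (hunif (t + 1) p Q 1 fun s hs n hn => ?_) ((hloc (t + 1)).mono fun n hn s hs => (hn s hs).1)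
        (fun s hs => (hVQ s hs.1.le).1) htm
      rw [one_mul]
      exact ((hVQ s hs.1.le).2.2 n hn).2
    simpa using! hV.sub (hδ t htR)
  · refine hasDerivAt_of_tendstoUniformlyOn (f := p)
      (g' := fun t => -(a t * (V t - δ t)) - B t (V t - δ t))
      (f' := fun n t => -(a t * (v n t - δ t)) - B t (v n t - δ t)) isOpen_Ioo
      (hunif (t + 1) _ _ (1 + 2 * M) fun s hs n hn => ?_)
      ((hloc (t + 1)).mono fun n hn s hs => (hn s hs).2)
      (fun s hs => (hVQ s hs.1.le).2.1) htm
    have hsR : R < s := by linarith [hs.1]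
    have e1 := ((hVQ s hs.1.le).2.2 n hn).1
    have e2 := hBl s hsR (v n s - δ s) (V s - δ s)
    rw [sub_sub_sub_cancel_right] at e2
    have e4 : -(a s * (v n s - δ s)) - B s (v n s - δ s) - (-(a s * (V s - δ s)) -
        B s (V s - δ s)) = -(a s * (v n s - V s) + (B s (v n s - δ s) - B s (V s - δ s))) := by
      ring
    rw [e4, abs_neg]
    refine (abs_add_le _ _).trans ?_
    rw [abs_mul, abs_of_pos (hapos s hsR)]
    have e5 : a s * |v n s - V s| ≤ M * |v n s - V s| := by
      gcongr
      exact haM s hsR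
    calc _ ≤ M * |v n s - V s| + (1 + M) * |v n s - V s| := add_le_add e5 e2
      _ = (1 + 2 * M) * |v n s - V s| := by ring
      _ ≤ _ := by gcongr
  · have h1 := (hVQ t ht.le).1
    refine le_of_tendsto ((((h1.sub_const (δ t)).pow 2).const_mul (a t)).const_mul (t * √t)) ?_
    filter_upwards [eventually_ge_atTop ⌈t⌉₊] with n hn
    have htn : t ≤ n := Nat.ceil_le.1 hn
    refine le_trans ?_ (hE n (ht.le.trans htn) t ⟨ht.le, htn⟩)
    have : 0 < t := by linarith
    gcongr
    exact le_add_of_nonneg_left (sq_nonneg _)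

/-! ### Existence for a profile -/

lemma antitoneOn_log_pow_div_sqrt :
    AntitoneOn (fun t : ℝ => Real.log t ^ 4 / √t) (Ici (Real.exp 8)) := by
  intro s hs t ht hst
  have hs' : Real.exp 8 ≤ s := hs
  have hs0 : 0 < s := (Real.exp_pos 8).trans_le hs'
  have ht0 : 0 < t := hs0.trans_le hst
  have e8 : Real.exp (1 / 8 : ℝ)⁻¹ = Real.exp 8 := by norm_num
  have key := Real.log_div_self_rpow_antitoneOn (a := 1 / 8) (by norm_num)
    (mem_Ici.2 (e8.le.trans hs')) (mem_Ici.2 (e8.le.trans (hs'.trans hst))) hst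
  have e : ∀ x : ℝ, 0 < x → Real.log x ^ 4 / √x = (Real.log x / x ^ (1 / 8 : ℝ)) ^ 4 := fun x hx => by
    rw [div_pow, ← Real.rpow_natCast (x ^ (1 / 8 : ℝ)), ← Real.rpow_mul hx.le, Real.sqrt_eq_rpow]
    norm_num
  simp only [e s hs0, e t ht0]
  have hl : 0 ≤ Real.log t := Real.log_nonneg (by
    have := Real.add_one_le_exp 8
    linarith)
  exact pow_le_pow_left₀ (by positivity) key 4

namespace InverseProfile

variable {f G φ h h1 h2 h3 : ℝ → ℝ} {c M r : ℝ}

section Existence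

lemma tendsto_leadingPart (P : InverseProfile f G φ h h1 h2 h3 c M r) :
    Tendsto (leadingPart G φ h) atTop atTop := by
  obtain ⟨K, hK, e1⟩ := P.isBigO_phase.exists_pos
  rw [IsBigOWith] at e1
  have hM := P.M_pos
  set A := 2 * M * Real.exp (2 * M) * φ (r + 1) with hA
  have hA0 : 0 < A := by
    have := P.φ_pos (r + 1) (by linarith)
    positivity
  have h1 : Tendsto (fun t : ℝ => G (t / 2) - 1) atTop atTop :=
    tendsto_atTop_add_const_right _ _ (P.G_tendsto.comp (tendsto_id.atTop_div_const two_pos))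
  refine tendsto_atTop_mono' _ ?_ h1
  have hlog := (tendsto_log_sq_div_sqrt.const_mul (A * K ^ 2)).eventually_le_const
    (u := 1) (by simp)
  filter_upwards [e1, eventually_gt_atTop (2 * r), eventually_gt_atTop (r + 1),
    eventually_const_mul_log_le (2 * K) one_pos, hlog] with t a1 a2 a3 a4 a5
  have htr : r < t := by linarith
  have ht0 := P.pos_of_lt htr
  have hl := P.one_le_log htr
  have ht1 : 1 ≤ t := by
    have := P.exp_one_le
    have := Real.add_one_le_exp 1
    linarith
  simp only [Real.norm_eq_abs, abs_of_pos (by linarith : 0 < Real.log t)] at a1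
  have a1' := abs_le.1 a1
  have hmid : t + phase φ h t ∈ Icc (t / 2) (3 * t / 2) := by
    constructor <;> linarith
  have b1 := P.abs_G_taylor_le a2 hmid
  have e : G (t + phase φ h t) - G t - φ t * (t + phase φ h t - t) =
      G (t + phase φ h t) - leadingPart G φ h t := by
    simp only [leadingPart]; ring
  rw [e, add_sub_cancel_left] at b1
  have b2 : G (t / 2) ≤ G (t + phase φ h t) := by
    have hd : ∀ x ∈ Icc (t / 2) (3 * t / 2), HasDerivAt G (φ x) x := fun x hx =>
      P.hasDerivAt_G x (lt_of_mem_Icc a2 hx)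
    refine monotoneOn_of_hasDerivWithinAt_nonneg (convex_Icc (t / 2) (3 * t / 2))
      (fun x hx => (hd x hx).continuousAt.continuousWithinAt)
      (fun x hx => (hd x (interior_subset hx)).hasDerivWithinAt)
      (fun x hx => (P.φ_pos x (lt_of_mem_Icc a2 (interior_subset hx))).le)
      ⟨le_rfl, by linarith⟩ hmid hmid.1
  have b3 : 2 * M * Real.exp (2 * M) * φ t / t * |phase φ h t| ^ 2 ≤ 1 := by
    have hφ := P.φ_le_of_le (by linarith : r < r + 1) a3.le
    have hφ0 := P.φ_pos t htr
    calc _ ≤ 2 * M * Real.exp (2 * M) * φ (r + 1) / √t * (K * Real.log t) ^ 2 := by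
          gcongr
          exact Real.sqrt_le_left (by linarith) |>.2 (by nlinarith)
      _ = A * K ^ 2 * (Real.log t ^ 2 / √t) := by ring
      _ ≤ 1 := a5
  have b4 := (abs_le.1 (b1.trans b3)).2
  linarith

set_option maxHeartbeats 1000000 in
/-- Existence near infinity, with an error of size `φ log² t / t`. -/
lemma exists_solution (P : InverseProfile f G φ h h1 h2 h3 c M r) :
    ∃ (y z : ℝ → ℝ) (Λ C : ℝ), 0 < C ∧ r ≤ Λ ∧ ∀ t > Λ, HasDerivAt y (z t) t ∧
      HasDerivAt z (-(1 / 4 * f (y t) * Real.exp (-t))) t ∧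
      |y t - leadingPart G φ h t| ≤ C * φ t * Real.log t ^ 2 / t := by
  have hc := P.c_pos
  have hM := P.M_pos
  obtain ⟨m', Y, Y', C, R₀, hC, hrR₀, hR₀⟩ := P.exists_corrected
  obtain ⟨τ, hτ, R₁, hR₁⟩ := P.exists_nonlinearity_bound (δ := √c / 8)
    (by have := Real.sqrt_pos.2 hc; positivity)
  obtain ⟨R₂, -, hR₂⟩ := P.eventually_frequency
  set C' := √(8 * M / c) * C with hC'
  have hC'0 : 0 < C' := by
    have : 0 < √(8 * M / c) := Real.sqrt_pos.2 (by positivity)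
    positivity
  obtain ⟨R₃, hR₃⟩ := eventually_atTop.1 (((tendsto_log_sq_div_sqrt.const_mul (C + C')).eventually_le_const
    (u := τ / 2) (by simpa using hτ)))
  set R := max (max R₀ R₁) (max (max R₂ R₃) (Real.exp 8)) with hR
  have hRR₀ : R₀ ≤ R := (le_max_left _ _).trans (le_max_left _ _)
  have hRR₁ : R₁ ≤ R := (le_max_right _ _).trans (le_max_left _ _)
  have hRR₂ : R₂ ≤ R := (le_max_left _ _).trans ((le_max_left _ _).trans (le_max_right _ _))
  have hRR₃ : R₃ ≤ R := (le_max_right _ _).trans ((le_max_left _ _).trans (le_max_right _ _))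
  have hRe : Real.exp 8 ≤ R := (le_max_right _ _).trans (le_max_right _ _)
  have hRr : r ≤ R := hrR₀.trans hRR₀
  have hR1 : 1 ≤ R := by
    have := Real.add_one_le_exp 8
    linarith
  set m := leadingPart G φ h with hm
  set δ : ℝ → ℝ := fun t => Y t - m t with hδ
  set κ : ℝ → ℝ := fun t => τ / 2 * φ t / √t with hκ
  set N : ℝ → ℝ → ℝ := fun t y => 1 / 4 * f y * Real.exp (-t) with hN
  -- the nonlinear remainder, truncated to the tube
  set B : ℝ → ℝ → ℝ := fun t w =>
    N t (Y t + clamp (κ t) w) - N t (Y t) - h t / t * clamp (κ t) w with hB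
  have hφp : ∀ t > R, 0 < φ t := fun t ht => P.φ_pos t (hRr.trans_lt ht)
  have hsp : ∀ t > R, 0 < √t := fun t ht => Real.sqrt_pos.2 (by linarith)
  have hκ0 : ∀ t > R, 0 ≤ κ t := fun t ht => by
    have := hφp t ht
    simp only [hκ]; positivity
  have hsmall : ∀ K ≤ C + C', ∀ t > R, K * φ t * Real.log t ^ 2 / t ≤ κ t := fun K hK t ht => by
    have h1 := hR₃ t (by linarith)
    have h2 := hφp t ht
    have h3 := hsp t ht
    have h4 : √t * √t = t := Real.mul_self_sqrt (by linarith)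
    calc _ = K * (Real.log t ^ 2 / √t) * φ t / √t := by
          rw [show K * (Real.log t ^ 2 / √t) * φ t / √t = K * φ t * Real.log t ^ 2 / (√t * √t) by
            field_simp, h4]
      _ ≤ τ / 2 * φ t / √t := by
          gcongr
          refine le_trans ?_ h1
          gcongr
  have hδκ : ∀ t > R, |δ t| ≤ κ t := fun t ht =>
    ((hR₀ t (hRR₀.trans_lt ht)).2.2.2.1).trans (hsmall C (by linarith) t ht)
  have htube : ∀ t > R, ∀ x, |x| ≤ κ t → |Y t + x - m t| ≤ τ * φ t / √t := fun t ht x hx => by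
    have : Y t + x - m t = δ t + x := by simp only [hδ]; ring
    rw [this]
    refine (abs_add_le _ _).trans ((add_le_add (hδκ t ht) hx).trans_eq ?_)
    simp only [hκ]; ring
  have hYc : ContinuousOn Y (Ioi R) := fun t ht =>
    (hR₀ t (hRR₀.trans_lt ht)).2.2.1.continuousAt.continuousWithinAt
  have hmc : ContinuousOn m (Ioi R) := fun t ht =>
    (hR₀ t (hRR₀.trans_lt ht)).1.continuousAt.continuousWithinAt
  have hφc : ContinuousOn φ (Ioi R) := fun t ht =>
    (P.hasDerivAt_φ t (hRr.trans_lt ht)).continuousAt.continuousWithinAt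
  have hac : ContinuousOn (fun t => h t / t) (Ioi R) := fun t ht =>
    (hR₂ t (hRR₂.trans_lt ht)).1.continuousAt.continuousWithinAt
  have hκc : ContinuousOn κ (Ioi R) :=
    (continuousOn_const.mul hφc).div Real.continuous_sqrt.continuousOn
      fun t ht => (hsp t ht).ne'
  have hNc : ∀ w : ℝ → ℝ, ContinuousOn w (Ioi R) → (∀ t > R, |w t| ≤ κ t) →
      ContinuousOn (fun t => N t (Y t + w t)) (Ioi R) := fun w hw hwκ => by
    have h1 : ContinuousOn (fun t => f (Y t + w t)) (Ioi R) := fun t ht =>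
      ((hR₁ t (hRR₁.trans_lt ht)).1 _ (htube t ht _ (hwκ t ht))).comp_continuousWithinAt
        (f := fun t => Y t + w t) ((hYc t ht).add (hw t ht))
    exact (continuousOn_const.mul h1).mul (by fun_prop)
  have hBc : ∀ x, ContinuousOn (fun t => B t (x - δ t)) (Ioi R) := fun x => by
    have h1 : ContinuousOn (fun t => clamp (κ t) (x - δ t)) (Ioi R) :=
      hκc.neg.sup ((continuousOn_const.sub (hYc.sub hmc)).inf hκc)
    have h2 := hNc _ h1 fun t ht => abs_clamp_le (hκ0 t ht) _
    have h3 := hNc (fun _ => 0) continuousOn_const fun t ht => by simpa using hκ0 t ht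
    simp only [add_zero] at h3
    exact (h2.sub h3).sub (hac.mul h1)
  have hBlip : ∀ t > R, ∀ u w, 8 * t * |B t u - B t w| ≤ √(h t / t) * |u - w| := by
    intro t ht u w
    refine (hR₂ t (hRR₂.trans_lt ht)).2.2.2 _ _ ?_
    have h1 := (hR₁ t (hRR₁.trans_lt ht)).2 _ _ (htube t ht _ (abs_clamp_le (hκ0 t ht) u))
      (htube t ht _ (abs_clamp_le (hκ0 t ht) w))
    have h2 : B t u - B t w = 1 / 4 * f (Y t + clamp (κ t) u) * Real.exp (-t) -
        1 / 4 * f (Y t + clamp (κ t) w) * Real.exp (-t) - h t / t *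
        (Y t + clamp (κ t) u - (Y t + clamp (κ t) w)) := by
      simp only [hB, hN]; ring
    rw [h2]
    refine h1.trans ?_
    have ht0 : 0 < t := by linarith
    gcongr ?_ * ?_
    rw [add_sub_add_left_eq_sub]
    exact abs_clamp_sub_clamp_le _ _ _
  set D : ℝ → ℝ := fun t => M * C ^ 2 * φ t ^ 2 * (Real.log t ^ 4 / √t) with hD
  have hDanti : AntitoneOn D (Ioi R) := by
    intro s hs t ht hst
    have h1 := P.φ_le_of_le (hRr.trans_lt hs) hst
    have h2 := hφp t ht
    have h3 := antitoneOn_log_pow_div_sqrt (hRe.trans (le_of_lt hs)) (hRe.trans (le_of_lt ht)) hst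
    simp only at h3
    simp only [hD]
    gcongr
  obtain ⟨u, p, Λ, hΛ, hup⟩ := exists_decaying_solution (a := fun t => h t / t)
    (a' := fun t => (h1 t - h t) / t ^ 2) (d := fun t => m' t - Y' t) (δ := δ) (D := D) (B := B)
    (R := R) (c := c) (M := M) hR1 hc
    (fun t ht => (hR₂ t (hRR₂.trans_lt ht)).1)
    (fun t ht => by
      have := P.le_h t (hRr.trans_lt ht)
      have : 0 < t := by linarith
      gcongr)
    (fun t ht => by
      have h1 := P.h_le t (hRr.trans_lt ht)
      rw [div_le_iff₀ (by linarith)]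
      nlinarith)
    (fun t ht => (hR₂ t (hRR₂.trans_lt ht)).2.2.1)
    (fun t ht => by simp [hB, clamp_zero (hκ0 t ht)])
    hBlip hBc
    (fun t ht => by
      obtain ⟨e1, -, e3, -, -⟩ := hR₀ t (hRR₀.trans_lt ht)
      have := e3.sub e1
      convert! this using 1
      ring)
    (fun t ht => by
      obtain ⟨-, -, -, -, e5⟩ := hR₀ t (hRR₀.trans_lt ht)
      have h1 := P.h_le t (hRr.trans_lt ht)
      have h2 := P.h_pos (hRr.trans_lt ht)
      have h3 := hsp t ht
      have ht0 : 0 < t := by linarith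
      have h4 : √t * √t = t := Real.mul_self_sqrt ht0.le
      have h5 := hφp t ht
      rw [← sq_abs]
      calc _ ≤ M / t * (C * φ t * Real.log t ^ 2 / t ^ 2) ^ 2 * √t := by gcongr
        _ = D t / t ^ 4 := by
          simp only [hD]
          generalize √t = s at *
          rw [← h4]
          field_simp)
    hDanti
  have hu : ∀ t > Λ, |u t| ≤ C' * φ t * Real.log t ^ 2 / t := fun t ht => by
    have htR := hΛ.trans ht
    have ht0 : 0 < t := by linarith
    have h1 := (hup t ht).2.2
    have h2 := P.le_h t (hRr.trans_lt htR)
    have h3 := hsp t htR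
    have h4 : √t * √t = t := Real.mul_self_sqrt ht0.le
    have h5 := hφp t htR
    have h6 : c * u t ^ 2 ≤ 8 * M * (C * φ t * Real.log t ^ 2 / t) ^ 2 := by
      have e1 : t * √t * (h t / t * u t ^ 2) = √t * (h t * u t ^ 2) := by field_simp
      have e2 : 8 * D t / t = √t * (8 * M * (C * φ t * Real.log t ^ 2 / t) ^ 2) := by
        simp only [hD]
        generalize √t = s at *
        rw [← h4]
        field_simp
      rw [e1, e2] at h1
      refine le_trans ?_ (le_of_mul_le_mul_left h1 h3)
      gcongr
    refine abs_le_of_sq_le_sq ?_ (by positivity)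
    have e3 : (C' * φ t * Real.log t ^ 2 / t) ^ 2 =
        8 * M / c * (C * φ t * Real.log t ^ 2 / t) ^ 2 := by
      have : √(8 * M / c) ^ 2 = 8 * M / c := Real.sq_sqrt (by positivity)
      rw [hC', show (√(8 * M / c) * C * φ t * Real.log t ^ 2 / t) ^ 2 =
        √(8 * M / c) ^ 2 * (C * φ t * Real.log t ^ 2 / t) ^ 2 by ring, this]
    rw [e3, div_mul_eq_mul_div, le_div_iff₀ hc]
    linarith
  refine ⟨fun t => Y t + u t, fun t => m' t + p t, Λ, C + C', by positivity, hRr.trans hΛ.le,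
    fun t ht => ?_⟩
  have htR := hΛ.trans ht
  obtain ⟨e1, e2, e3, e4, e5⟩ := hR₀ t (hRR₀.trans_lt htR)
  obtain ⟨g1, g2, -⟩ := hup t ht
  refine ⟨?_, ?_, ?_⟩
  · have := e3.add g1
    convert! this using 1
    ring
  · have := e2.add g2
    convert! this using 1
    simp only [hB, clamp_of_abs_le ((hu t ht).trans (hsmall C' (by linarith) t htR)), hN]
    ring
  · have : Y t + u t - m t = (Y t - m t) + u t := by ring
    rw [this]
    refine (abs_add_le _ _).trans ((add_le_add e4 (hu t ht)).trans_eq ?_)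
    ring

end Existence

end InverseProfile

/-! ### The profile of an admissible nonlinearity -/

lemma exists_lt_of_integrableOn_one_div {g g' : ℝ → ℝ} {a b : ℝ} (hpos : ∀ s > a, 0 < g s)
    (hg : ∀ s > a, HasDerivAt g (g' s) s) (hint : IntegrableOn (fun u => 1 / g u) (Ioi b))
    (K x : ℝ) : ∃ s > x, K < g' s := by
  by_contra! hcon
  -- otherwise `g` grows at most linearly
  set a₁ := max (max a b) (max x 1) + 1 with ha₁
  have h1 : a < a₁ := by
    linarith [(le_max_left a b).trans (le_max_left (max a b) (max x 1))]
  have h2 : b < a₁ := by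
    linarith [(le_max_right a b).trans (le_max_left (max a b) (max x 1))]
  have h3 : x < a₁ := by
    linarith [(le_max_left x 1).trans (le_max_right (max a b) (max x 1))]
  have h4 : 1 < a₁ := by
    linarith [(le_max_right x 1).trans (le_max_right (max a b) (max x 1))]
  set L := g a₁ + |K| with hL
  have hlin : ∀ u > a₁, g u ≤ L * u := fun u hu => by
    have hd : ∀ z ∈ Icc a₁ u, HasDerivAt g (g' z) z := fun z hz => hg z (h1.trans_le hz.1)
    have := (convex_Icc a₁ u).image_sub_le_mul_sub_of_deriv_le
      (fun z hz => (hd z hz).continuousAt.continuousWithinAt)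
      (fun z hz => (hd z (interior_subset hz)).differentiableAt.differentiableWithinAt)
      (C := |K|) (fun z hz => by
        rw [(hd z (interior_subset hz)).deriv]
        exact (hcon z (h3.trans_le (interior_subset hz).1)).trans (le_abs_self K))
      a₁ (left_mem_Icc.2 (le_of_lt hu)) u (right_mem_Icc.2 (le_of_lt hu)) (le_of_lt hu)
    have h5 := hpos a₁ h1
    have h6 := abs_nonneg K
    rw [hL]
    nlinarith
  refine not_integrableOn_Ioi_inv (a := a₁) ?_
  refine Integrable.mono' (((hint.mono_set (Ioi_subset_Ioi h2.le)).const_mul L))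
    measurable_inv.aestronglyMeasurable ?_
  filter_upwards [ae_restrict_mem measurableSet_Ioi] with u hu
  have hu' : a₁ < u := hu
  have hu0 : 0 < u := by linarith
  have hgu := hpos u (h1.trans hu')
  rw [norm_inv, Real.norm_eq_abs, abs_of_pos hu0, inv_eq_one_div, ← mul_div_assoc, mul_one,
    div_le_div_iff₀ hu0 hgu]
  linarith [hlin u hu']

/-- What the hypotheses say about the exponent near infinity. The concave case `q < 0` and the
decreasing case are excluded because there `g` grows at most linearly, so that `1 / g` is not
integrable. -/
lemma exists_exponent_bounds {g : ℝ → ℝ} (hG1 : CondG1 g) (hG2 : CondG2 g) :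
    ∃ ℓ > 0, ∃ C > 0, ∃ a > 0, Tendsto (ratioH g) atTop (𝓝 ℓ) ∧ ∀ s > a,
      0 < g s ∧ 0 < deriv g s ∧ HasDerivAt g (deriv g s) s ∧
      HasDerivAt (deriv g) (deriv (deriv g) s) s ∧ 0 < deriv (deriv g) s ∧
      ℓ / 2 ≤ ratioH g s ∧ ratioH g s ≤ 2 * ℓ ∧
      HasDerivAt (ratioH g) (iteratedDeriv 1 (ratioH g) s) s ∧
      HasDerivAt (iteratedDeriv 1 (ratioH g)) (iteratedDeriv 2 (ratioH g) s) s ∧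
      HasDerivAt (iteratedDeriv 2 (ratioH g)) (iteratedDeriv 3 (ratioH g) s) s ∧
      ∀ k ∈ ({1, 2, 3} : Set ℕ), |iteratedDeriv k (ratioH g) s| ≤ C * (deriv g s / g s) ^ k := by
  obtain ⟨q, hq, hlim⟩ := hG1.limit
  obtain ⟨C, hC, s₀, hs₀, hsm, hH⟩ := hG2
  obtain ⟨b, hint⟩ := hG1.integrable.exists
  have hq' : 1 / q ≠ 0 := one_div_ne_zero hq
  obtain ⟨a₁, ha₁⟩ := eventually_atTop.1 (hG1.pos.and (hlim.eventually_ne hq'))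
  set a₂ := max a₁ s₀ with ha₂
  have h1 : ∀ s > a₂, a₁ ≤ s ∧ s₀ < s := fun s hs =>
    ⟨(le_max_left _ _).trans (le_of_lt hs), (le_max_right _ _).trans_lt hs⟩
  have hsm1 : ContDiffOn ℝ 4 (deriv g) (Ioi s₀) :=
    hsm.deriv_of_isOpen isOpen_Ioi (by norm_num)
  have hsm2 : ContDiffOn ℝ 3 (deriv (deriv g)) (Ioi s₀) :=
    hsm1.deriv_of_isOpen isOpen_Ioi (by norm_num)
  have hder : ∀ {u : ℝ → ℝ} {x : ℝ} {n : WithTop ℕ∞}, ContDiffOn ℝ n u (Ioi x) → n ≠ 0 →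
      ∀ s > x, HasDerivAt u (deriv u s) s := fun hu hn s hs =>
    ((hu.differentiableOn hn).differentiableAt (Ioi_mem_nhds hs)).hasDerivAt
  have hd1 := hder hsm (by norm_num)
  have hd2 := hder hsm1 (by norm_num)
  have hpos : ∀ s > a₂, 0 < g s := fun s hs => (ha₁ s (h1 s hs).1).1
  have hunb : ∀ K x : ℝ, ∃ s > x, K < deriv g s := fun K x =>
    exists_lt_of_integrableOn_one_div (a := a₂) hpos (fun s hs => hd1 s (h1 s hs).2) hint K x
  have hne : ∀ s > a₂, deriv g s ≠ 0 := fun s hs h0 => by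
    have := (ha₁ s (h1 s hs).1).2
    simp [ratioH, h0] at this
  have hg' : ∀ s > a₂, 0 < deriv g s := by
    intro s hs
    by_contra hneg
    obtain ⟨x, hx, hx'⟩ := hunb 0 s
    obtain ⟨z, hz, hz0⟩ := intermediate_value_Icc (le_of_lt hx)
      (hsm1.continuousOn.mono fun z hz => (h1 z (lt_of_lt_of_le hs hz.1)).2)
      (⟨not_lt.1 hneg, le_of_lt hx'⟩ : (0 : ℝ) ∈ Icc (deriv g s) (deriv g x))
    exact hne z (lt_of_lt_of_le hs hz.1) hz0
  have hratio : ∀ s > a₂, deriv (deriv g) s = ratioH g s * (deriv g s) ^ 2 / g s := fun s hs => by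
    have := (hpos s hs).ne'
    have := hne s hs
    unfold ratioH
    field_simp
  have hℓ : 0 < 1 / q := by
    by_contra hneg
    have hneg' : 1 / q < 0 := lt_of_le_of_ne (not_lt.1 hneg) hq'
    obtain ⟨a₃, ha₃⟩ := eventually_atTop.1 (hlim.eventually_lt_const hneg')
    set x := max a₂ a₃ + 1 with hx
    have hxa : a₂ < x := by linarith [le_max_left a₂ a₃]
    have hanti : AntitoneOn (deriv g) (Ici x) := by
      have hd : ∀ z ∈ Ici x, HasDerivAt (deriv g) (deriv (deriv g) z) z := fun z hz =>
        hd2 z (h1 z (hxa.trans_le hz)).2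
      refine antitoneOn_of_hasDerivWithinAt_nonpos (convex_Ici x)
        (fun z hz => (hd z hz).continuousAt.continuousWithinAt)
        (fun z hz => (hd z (interior_subset hz)).hasDerivWithinAt) fun z hz => ?_
      have hz' : x ≤ z := interior_subset hz
      have hza := hxa.trans_le hz'
      rw [hratio z hza]
      have e1 := ha₃ z (by linarith [le_max_right a₂ a₃])
      exact div_nonpos_of_nonpos_of_nonneg
        (mul_nonpos_of_nonpos_of_nonneg e1.le (sq_nonneg _)) (hpos z hza).le
    obtain ⟨s, hs, hs'⟩ := hunb (deriv g x) x
    exact absurd (hanti self_mem_Ici (le_of_lt hs) (le_of_lt hs)) (not_le.2 hs')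
  set ℓ := 1 / q with hℓdef
  obtain ⟨a₃, ha₃⟩ := eventually_atTop.1 ((hlim.eventually_const_le (half_lt_self hℓ)).and
    (hlim.eventually_le_const (by linarith : ℓ < 2 * ℓ)))
  set a := max a₂ a₃ with ha
  have haa₂ : a₂ ≤ a := le_max_left _ _
  have has₀ : s₀ ≤ a := (le_max_right _ _).trans haa₂
  have hsmH : ContDiffOn ℝ 3 (ratioH g) (Ioi a) := by
    have hsub : Ioi a ⊆ Ioi s₀ := Ioi_subset_Ioi has₀
    refine ContDiffOn.div ?_ ?_ fun s hs => pow_ne_zero 2 (hne s (haa₂.trans_lt hs))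
    · exact ((hsm.of_le (by norm_num)).mono hsub).mul (hsm2.mono hsub)
    · exact ((hsm1.of_le (by norm_num)).mono hsub).pow 2
  have hsmH1 : ContDiffOn ℝ 2 (deriv (ratioH g)) (Ioi a) :=
    hsmH.deriv_of_isOpen isOpen_Ioi (by norm_num)
  have hsmH2 : ContDiffOn ℝ 1 (deriv (deriv (ratioH g))) (Ioi a) :=
    hsmH1.deriv_of_isOpen isOpen_Ioi (by norm_num)
  have i1 : iteratedDeriv 1 (ratioH g) = deriv (ratioH g) := iteratedDeriv_one
  have i2 : iteratedDeriv 2 (ratioH g) = deriv (deriv (ratioH g)) := by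
    rw [iteratedDeriv_succ, i1]
  have i3 : iteratedDeriv 3 (ratioH g) = deriv (deriv (deriv (ratioH g))) := by
    rw [iteratedDeriv_succ, i2]
  refine ⟨ℓ, hℓ, C, hC, a, hs₀.trans_le has₀, hlim, fun s hs => ?_⟩
  have hsa₂ := haa₂.trans_lt hs
  have hss₀ := has₀.trans_lt hs
  obtain ⟨b1, b2⟩ := ha₃ s ((le_max_right _ _).trans (le_of_lt hs))
  refine ⟨hpos s hsa₂, hg' s hsa₂, hd1 s hss₀, hd2 s hss₀, ?_, b1, b2, ?_, ?_, ?_,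
    fun k hk => (hH k hk s hss₀).le⟩
  · rw [hratio s hsa₂]
    have := hpos s hsa₂
    have := hg' s hsa₂
    have : 0 < ratioH g s := by linarith
    positivity
  · rw [i1]; exact hder hsmH (by norm_num) s hs
  · rw [i1, i2]; exact hder hsmH1 (by norm_num) s hs
  · rw [i2, i3]; exact hder hsmH2 (by norm_num) s hs

/-- A function that is continuous on `[0, ∞)` and convex increasing near infinity is inverted by
`invG` at all large arguments. -/
lemma exists_invG_spec {g : ℝ → ℝ} {a : ℝ} (ha : 0 < a) (hcont : ContinuousOn g (Ici 0))
    (hg : ∀ s > a, HasDerivAt g (deriv g s) s) (hg' : ∀ s > a, 0 < deriv g s)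
    (hg2 : ∀ s > a, HasDerivAt (deriv g) (deriv (deriv g) s) s)
    (hg2' : ∀ s > a, 0 < deriv (deriv g) s) :
    ∃ r, (∀ ρ > r, a < invG g ρ ∧ g (invG g ρ) = ρ ∧
      HasDerivAt (invG g) (1 / deriv g (invG g ρ)) ρ) ∧ Tendsto (invG g) atTop atTop := by
  have hcont' : ContinuousOn g (Ioi a) := fun s hs => (hg s hs).continuousAt.continuousWithinAt
  have hmono : StrictMonoOn g (Ioi a) := by
    refine strictMonoOn_of_deriv_pos (convex_Ioi a) hcont' fun s hs => ?_
    rw [interior_Ioi] at hs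
    exact hg' s hs
  have hmono' : MonotoneOn (deriv g) (Ioi a) := by
    refine monotoneOn_of_deriv_nonneg (convex_Ioi a)
      (fun s hs => (hg2 s hs).continuousAt.continuousWithinAt)
      (fun s hs => (hg2 s (interior_subset hs)).differentiableAt.differentiableWithinAt)
      fun s hs => (hg2' s (interior_subset hs)).le
  set a₁ := a + 1 with ha₁
  have haa₁ : a₁ ∈ Ioi a := by simp [ha₁]
  have htop : Tendsto g atTop atTop := by
    have hlin : Tendsto (fun s => g a₁ + deriv g a₁ * (s - a₁)) atTop atTop := by
      refine tendsto_atTop_add_const_left _ _ (Tendsto.const_mul_atTop (hg' a₁ haa₁) ?_)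
      exact tendsto_atTop_add_const_right _ _ tendsto_id
    refine tendsto_atTop_mono' _ ?_ hlin
    filter_upwards [eventually_ge_atTop a₁] with s hs
    have hsub : Ici a₁ ⊆ Ioi a := Ici_subset_Ioi.2 haa₁
    have := (convex_Ici a₁).mul_sub_le_image_sub_of_le_deriv (hcont'.mono hsub)
      (fun z hz => (hg z (hsub (interior_subset hz))).differentiableAt.differentiableWithinAt)
      (C := deriv g a₁) (fun z hz => hmono' haa₁ (hsub (interior_subset hz)) (interior_subset hz))
      a₁ self_mem_Ici s hs hs
    linarith
  obtain ⟨L, hL⟩ := isCompact_Icc.exists_bound_of_continuousOn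
    (hcont.mono (Icc_subset_Ici_self : Icc 0 a₁ ⊆ Ici 0))
  -- above `L` every preimage lies in the region where `g` is increasing
  have hspec : ∀ ρ > L, a₁ < invG g ρ ∧ g (invG g ρ) = ρ := by
    intro ρ hρ
    obtain ⟨b, hb, hb'⟩ := ((eventually_ge_atTop a₁).and (htop.eventually_ge_atTop ρ)).exists
    have hLa : g a₁ ≤ ρ := ((le_abs_self _).trans (hL a₁ ⟨by linarith, le_rfl⟩)).trans (le_of_lt hρ)
    obtain ⟨s, hs, hsρ⟩ := intermediate_value_Icc hb
      (hcont.mono fun z hz => (by have := hz.1; simp only [mem_Ici]; linarith))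
      (⟨hLa, hb'⟩ : ρ ∈ Icc (g a₁) (g b))
    have hex : ∃ s ∈ Ici (0 : ℝ), g s = ρ := ⟨s, by simp only [mem_Ici]; linarith [hs.1], hsρ⟩
    have h1 : invG g ρ ∈ Ici (0 : ℝ) := Function.invFunOn_mem hex
    have h2 : g (invG g ρ) = ρ := Function.invFunOn_eq hex
    refine ⟨?_, h2⟩
    by_contra hle
    have := (le_abs_self _).trans (hL (invG g ρ) ⟨h1, not_lt.1 hle⟩)
    linarith
  have hlt : ∀ ρ > L, ∀ x > a, g x < ρ → x < invG g ρ := fun ρ hρ x hx hxρ => by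
    obtain ⟨h1, h2⟩ := hspec ρ hρ
    rw [← hmono.lt_iff_lt hx (haa₁.trans h1), h2]
    exact hxρ
  have hgt : ∀ ρ > L, ∀ x > a, ρ < g x → invG g ρ < x := fun ρ hρ x hx hxρ => by
    obtain ⟨h1, h2⟩ := hspec ρ hρ
    rw [← hmono.lt_iff_lt (haa₁.trans h1) hx, h2]
    exact hxρ
  have hcontG : ∀ ρ > L, ContinuousAt (invG g) ρ := by
    intro ρ hρ
    obtain ⟨h1, h2⟩ := hspec ρ hρ
    refine tendsto_order.2 ⟨fun x hx => ?_, fun x hx => ?_⟩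
    · have hm : max x a₁ < invG g ρ := max_lt hx h1
      have hma : a < max x a₁ := lt_of_lt_of_le haa₁ (le_max_right _ _)
      have : g (max x a₁) < ρ := by
        conv_rhs => rw [← h2]
        exact hmono hma (haa₁.trans h1) hm
      filter_upwards [Ioi_mem_nhds hρ, Ioi_mem_nhds this] with z hz hz'
      exact (le_max_left _ _).trans_lt (hlt z hz _ hma hz')
    · have hxa : a < x := (lt_trans haa₁ h1).trans hx
      have : ρ < g x := by
        conv_lhs => rw [← h2]
        exact hmono (haa₁.trans h1) hxa hx
      filter_upwards [Ioi_mem_nhds hρ, Iio_mem_nhds this] with z hz hz'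
      exact hgt z hz _ hxa hz'
  refine ⟨L, fun ρ hρ => ?_, ?_⟩
  · obtain ⟨h1, h2⟩ := hspec ρ hρ
    have h3 : a < invG g ρ := haa₁.trans h1
    refine ⟨h3, h2, ?_⟩
    rw [one_div]
    refine HasDerivAt.of_local_left_inverse (hcontG ρ hρ) (hg _ h3) (hg' _ h3).ne' ?_
    filter_upwards [Ioi_mem_nhds hρ] with z hz using (hspec z hz).2
  · refine tendsto_atTop.2 fun b => ?_
    filter_upwards [eventually_gt_atTop L, eventually_gt_atTop (g (max b a₁))] with ρ hρ hρ'
    exact (le_max_left _ _).trans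
      (hlt ρ hρ _ (lt_of_lt_of_le haa₁ (le_max_right _ _)) hρ').le

/-- The inverse of the exponent of an admissible nonlinearity has the profile structure. -/
lemma exists_inverseProfile {f : ℝ → ℝ} (hf : IsNonlinearity f) (hG1 : CondG1 (logNonlin f))
    (hG2 : CondG2 (logNonlin f)) : ∃ (h1 h2 h3 : ℝ → ℝ) (c M r : ℝ),
    InverseProfile f (invG (logNonlin f)) (fun t => 1 / deriv (logNonlin f) (invG (logNonlin f) t))
      (fun t => ratioH (logNonlin f) (invG (logNonlin f) t)) h1 h2 h3 c M r := by
  set g := logNonlin f with hgdef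
  obtain ⟨ℓ, hℓ, C, hC, a, ha, hlim, hs⟩ := exists_exponent_bounds hG1 hG2
  have hcont : ContinuousOn g (Ici 0) :=
    hf.contDiffOn.continuousOn.log fun s hs => (hf.pos s hs).ne'
  obtain ⟨r₀, hr₀, htop⟩ := exists_invG_spec ha hcont (fun s h => (hs s h).2.2.1)
    (fun s h => (hs s h).2.1) (fun s h => (hs s h).2.2.2.1) (fun s h => (hs s h).2.2.2.2.1)
  set G := invG g with hG
  set φ : ℝ → ℝ := fun t => 1 / deriv g (G t) with hφ
  set h : ℝ → ℝ := fun t => ratioH g (G t) with hh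
  set r := max r₀ (Real.exp 1) with hr
  -- the logarithmic derivatives `ρ^k φ^k H^(k)(G)` and the combinations giving those of `h`
  set k1 : ℝ → ℝ := fun t => t * φ t * iteratedDeriv 1 (ratioH g) (G t) with hk1
  set k2 : ℝ → ℝ := fun t => t ^ 2 * φ t ^ 2 * iteratedDeriv 2 (ratioH g) (G t) with hk2
  set k3 : ℝ → ℝ := fun t => t ^ 3 * φ t ^ 3 * iteratedDeriv 3 (ratioH g) (G t) with hk3
  set h2 : ℝ → ℝ := fun t => (1 - h t) * k1 t + k2 t with hh2
  set h3 : ℝ → ℝ := fun t => -(k1 t * k1 t) + (1 - h t) * h2 t + ((2 - 2 * h t) * k2 t + k3 t)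
    with hh3
  have hrr : ∀ t > r, r₀ < t ∧ 0 < t := fun t ht =>
    ⟨(le_max_left _ _).trans_lt ht, (Real.exp_pos 1).trans ((le_max_right _ _).trans_lt ht)⟩
  have hGd : ∀ t > r, HasDerivAt G (φ t) t := fun t ht => (hr₀ t (hrr t ht).1).2.2
  have hGa : ∀ t > r, a < G t := fun t ht => (hr₀ t (hrr t ht).1).1
  have hgG : ∀ t > r, g (G t) = t := fun t ht => (hr₀ t (hrr t ht).1).2.1
  have hg' : ∀ t > r, 0 < deriv g (G t) := fun t ht => (hs _ (hGa t ht)).2.1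
  have hφ0 : ∀ t > r, 0 < φ t := fun t ht => one_div_pos.2 (hg' t ht)
  have hφd : ∀ t > r, HasDerivAt φ (-(h t * φ t / t)) t := fun t ht => by
    have e1 := ((hs _ (hGa t ht)).2.2.2.1.comp t (hGd t ht)).inv (hg' t ht).ne'
    have e2 := (hg' t ht).ne'
    have e3 := (hrr t ht).2.ne'
    simp only [hφ, one_div]
    convert! e1 using 1
    simp only [hh, hφ, ratioH, hgG t ht, Function.comp]
    field_simp
  have hhd : ∀ t > r, HasDerivAt h (k1 t / t) t := fun t ht => by
    have e1 := (hs _ (hGa t ht)).2.2.2.2.2.2.2.1.comp t (hGd t ht)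
    have e3 := (hrr t ht).2.ne'
    convert! e1 using 1
    simp only [hk1]
    field_simp
  have hk1d : ∀ t > r, HasDerivAt k1 (h2 t / t) t := fun t ht => by
    have e1 := (hs _ (hGa t ht)).2.2.2.2.2.2.2.2.1.comp t (hGd t ht)
    have e3 := (hrr t ht).2.ne'
    have := ((hasDerivAt_id t).mul (hφd t ht)).mul e1
    convert! this using 1
    simp only [hh2, hk1, hk2, id, Pi.mul_apply, Function.comp]
    field_simp
    ring
  have hk2d : ∀ t > r, HasDerivAt k2 (((2 - 2 * h t) * k2 t + k3 t) / t) t := fun t ht => by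
    have e1 := (hs _ (hGa t ht)).2.2.2.2.2.2.2.2.2.1.comp t (hGd t ht)
    have e3 := (hrr t ht).2.ne'
    have := (((hasDerivAt_id t).pow 2).mul ((hφd t ht).pow 2)).mul e1
    convert! this using 1
    simp only [hk3, hk2, id, Pi.mul_apply, Pi.pow_apply, Function.comp]
    field_simp
    push_cast
    ring
  have hh2d : ∀ t > r, HasDerivAt h2 (h3 t / t) t := fun t ht => by
    have := (((hhd t ht).const_sub 1).mul (hk1d t ht)).add (hk2d t ht)
    convert! this using 1
    simp only [hh3]
    ring
  have hlo : ∀ t > r, ℓ / 2 ≤ h t := fun t ht => (hs _ (hGa t ht)).2.2.2.2.2.1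
  have hhi : ∀ t > r, h t ≤ 2 * ℓ := fun t ht => (hs _ (hGa t ht)).2.2.2.2.2.2.1
  have hkb : ∀ k ∈ ({1, 2, 3} : Set ℕ), ∀ t > r,
      |t ^ k * φ t ^ k * iteratedDeriv k (ratioH g) (G t)| ≤ C := fun k hk t ht => by
    have e1 := (hs _ (hGa t ht)).2.2.2.2.2.2.2.2.2.2 k hk
    rw [hgG t ht] at e1
    have e2 := hφ0 t ht
    have e3 := (hrr t ht).2
    have e4 := hg' t ht
    rw [abs_mul, abs_of_pos (by positivity)]
    calc _ ≤ t ^ k * φ t ^ k * (C * (deriv g (G t) / t) ^ k) := by gcongr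
      _ = C * (t * φ t * (deriv g (G t) / t)) ^ k := by rw [mul_pow, mul_pow]; ring
      _ = C := by
        have : t * φ t * (deriv g (G t) / t) = 1 := by simp only [hφ]; field_simp
        rw [this, one_pow, mul_one]
  have bk1 : ∀ t > r, |k1 t| ≤ C := fun t ht => by
    have := hkb 1 (by simp) t ht
    simpa only [pow_one] using this
  have bk2 : ∀ t > r, |k2 t| ≤ C := hkb 2 (by simp)
  have bk3 : ∀ t > r, |k3 t| ≤ C := hkb 3 (by simp)
  have b1h : ∀ t > r, |1 - h t| ≤ 1 + 2 * ℓ := fun t ht => by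
    have := hlo t ht
    have := hhi t ht
    rw [abs_le]
    constructor <;> linarith
  have bh2 : ∀ t > r, |h2 t| ≤ (1 + 2 * ℓ) * C + C := fun t ht => by
    refine (abs_add_le _ _).trans (add_le_add ?_ (bk2 t ht))
    rw [abs_mul]
    exact mul_le_mul (b1h t ht) (bk1 t ht) (abs_nonneg _) (by positivity)
  set M₂ := (1 + 2 * ℓ) * C + C with hM₂
  have hM₂0 : 0 < M₂ := by positivity
  set M₃ := C * C + (1 + 2 * ℓ) * M₂ + (2 * (1 + 2 * ℓ) * C + C) with hM₃
  have hM₃0 : 0 < M₃ := by positivity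
  have bh3 : ∀ t > r, |h3 t| ≤ M₃ := fun t ht => by
    have f1 := b1h t ht
    refine (abs_add_le _ _).trans (add_le_add ((abs_add_le _ _).trans (add_le_add ?_ ?_))
      ((abs_add_le _ _).trans (add_le_add ?_ (bk3 t ht))))
    · rw [abs_neg, abs_mul]
      exact mul_le_mul (bk1 t ht) (bk1 t ht) (abs_nonneg _) hC.le
    · rw [abs_mul]
      exact mul_le_mul f1 (bh2 t ht) (abs_nonneg _) (by positivity)
    · rw [abs_mul, show 2 - 2 * h t = 2 * (1 - h t) by ring, abs_mul, abs_two]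
      exact mul_le_mul (by linarith) (bk2 t ht) (abs_nonneg _) (by positivity)
  refine ⟨k1, h2, h3, ℓ / 2, 2 * ℓ + C + M₂ + M₃, r, ?_⟩
  exact {
    exp_one_le := le_max_right _ _
    c_pos := half_pos hℓ
    hasDerivAt_G := hGd
    φ_pos := hφ0
    hasDerivAt_φ := hφd
    hasDerivAt_h := hhd
    hasDerivAt_h1 := hk1d
    hasDerivAt_h2 := hh2d
    le_h := hlo
    h_le := fun t ht => (hhi t ht).trans (by linarith)
    h1_le := fun t ht => (bk1 t ht).trans (by linarith)
    h2_le := fun t ht => (bh2 t ht).trans (by linarith)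
    h3_le := fun t ht => (bh3 t ht).trans (by linarith)
    h1_tendsto := tendsto_zero_of_tendsto_of_bounded
      ((Real.exp_pos 1).trans_le (le_max_right _ _)) hhd hk1d bh2 (hlim.comp htop)
    G_tendsto := htop
    f_G := fun t ht => by
      have e1 := hgG t ht
      rw [hgdef, logNonlin] at e1
      rw [← Real.exp_log (hf.pos _ (ha.trans (hGa t ht)).le), e1]
    hasDerivAt_f := fun t ht => by
      have e1 := (hs _ (hGa t ht)).2.2.1.exp
      rw [hgG t ht] at e1
      have e2 : Real.exp t / φ t = Real.exp t * deriv g (G t) := by simp only [hφ]; field_simp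
      rw [e2]
      refine e1.congr_of_eventuallyEq ?_
      filter_upwards [Ioi_mem_nhds (ha.trans (hGa t ht))] with s hs
      simp only [hgdef, logNonlin]
      rw [Real.exp_log (hf.pos s (le_of_lt hs))] }

/-! ### Backward uniqueness and the main result -/

/-- Backward uniqueness for the equation, down to and including the left end point. -/
lemma IsODESolution.eqOn_of_eqOn_Ici {f : ℝ → ℝ} (hf : IsNonlinearity f) {Λ T : ℝ}
    {y₁ y₂ : ℝ → ℝ} (h₁ : IsODESolution f Λ y₁) (h₂ : IsODESolution f Λ y₂)
    (h : ∀ t ≥ T, y₁ t = y₂ t) : EqOn y₁ y₂ (Ici Λ) := by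
  obtain ⟨hpos₁, z₁, hz₁⟩ := h₁
  obtain ⟨hpos₂, z₂, hz₂⟩ := h₂
  intro t₀ ht₀
  set b := max (max T Λ) t₀ + 1 with hb
  have hbT : T < b := by linarith [(le_max_left T Λ).trans (le_max_left (max T Λ) t₀)]
  have hbΛ : Λ < b := by linarith [(le_max_right T Λ).trans (le_max_left (max T Λ) t₀)]
  have hbt : t₀ ≤ b := by linarith [le_max_right (max T Λ) t₀]
  have hsub : Icc Λ b ⊆ Ici Λ := Icc_subset_Ici_self
  have hat : ∀ {u : ℝ → ℝ} {u' t : ℝ}, Λ < t → HasDerivWithinAt u u' (Ici Λ) t →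
      HasDerivAt u u' t := fun ht hu => hu.hasDerivAt (Ici_mem_nhds ht)
  have hcy : ∀ {u u' : ℝ → ℝ}, (∀ t, Λ ≤ t → HasDerivWithinAt u (u' t) (Ici Λ) t) →
      ContinuousOn u (Icc Λ b) := fun hu t ht => ((hu t ht.1).continuousWithinAt).mono hsub
  have c1 := hcy fun t ht => (hz₁ t ht).1
  have c2 := hcy fun t ht => (hz₂ t ht).1
  obtain ⟨B₁, hB₁⟩ := isCompact_Icc.exists_bound_of_continuousOn c1
  obtain ⟨B₂, hB₂⟩ := isCompact_Icc.exists_bound_of_continuousOn c2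
  set B := max B₁ B₂ with hB
  obtain ⟨K, hK⟩ := (hf.contDiffOn.mono (Icc_subset_Ici_self : Icc 0 B ⊆ Ici 0)).exists_lipschitzOnWith
    one_ne_zero (convex_Icc 0 B) isCompact_Icc
  have hzb : z₁ b = z₂ b := by
    refine (hat hbΛ (hz₁ b hbΛ.le).1).unique ((hat hbΛ (hz₂ b hbΛ.le).1).congr_of_eventuallyEq ?_)
    filter_upwards [Ioi_mem_nhds hbT] with t ht using h t (le_of_lt ht)
  set F : ℝ → ℝ × ℝ → ℝ × ℝ := fun t x => (x.2, -(1 / 4 * f x.1 * Real.exp (-t))) with hF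
  have key := ODE_solution_unique_of_mem_Icc_left (v := F)
    (s := fun _ => Icc 0 B ×ˢ univ) (K := ⟨1 + 1 / 4 * K * Real.exp (-Λ), by positivity⟩)
    (f := fun t => (y₁ t, z₁ t)) (g := fun t => (y₂ t, z₂ t)) (a := Λ) (b := b)
    (fun t ht => by
      refine LipschitzOnWith.of_dist_le_mul fun x hx w hw => ?_
      rw [Prod.dist_eq, Real.dist_eq, Real.dist_eq]
      have e1 : dist x.1 w.1 ≤ dist x w := le_max_left _ _
      have e2 : |x.2 - w.2| ≤ dist x w := by rw [← Real.dist_eq]; exact le_max_right _ _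
      have e0 : 0 ≤ dist x w := dist_nonneg
      have e3 := hK.dist_le_mul x.1 hx.1 w.1 hw.1
      rw [Real.dist_eq] at e3
      have e4 : Real.exp (-t) ≤ Real.exp (-Λ) := Real.exp_le_exp.2 (by linarith [ht.1])
      have e5 : 0 ≤ 1 / 4 * (K : ℝ) * Real.exp (-Λ) * dist x w := by positivity
      show max _ _ ≤ (1 + 1 / 4 * K * Real.exp (-Λ)) * dist x w
      refine max_le (by linarith) ?_
      have e6 : (F t x).2 - (F t w).2 = -(1 / 4 * Real.exp (-t) * (f x.1 - f w.1)) := by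
        simp only [hF]; ring
      rw [e6, abs_neg, abs_mul, abs_of_pos (by positivity)]
      calc _ ≤ 1 / 4 * Real.exp (-Λ) * (K * dist x w) := by
            gcongr
            exact e3.trans (by gcongr)
        _ ≤ _ := by linarith)
    (c1.prodMk (hcy fun t ht => (hz₁ t ht).2))
    (fun t ht => ((hat ht.1 (hz₁ t ht.1.le).1).prodMk (hat ht.1 (hz₁ t ht.1.le).2)).hasDerivWithinAt)
    (fun t ht => ⟨⟨hpos₁ t ht.1.le, (le_abs_self _).trans
      ((hB₁ t ⟨ht.1.le, ht.2⟩).trans (le_max_left _ _))⟩, mem_univ _⟩)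
    (c2.prodMk (hcy fun t ht => (hz₂ t ht).2))
    (fun t ht => ((hat ht.1 (hz₂ t ht.1.le).1).prodMk (hat ht.1 (hz₂ t ht.1.le).2)).hasDerivWithinAt)
    (fun t ht => ⟨⟨hpos₂ t ht.1.le, (le_abs_self _).trans
      ((hB₂ t ⟨ht.1.le, ht.2⟩).trans (le_max_right _ _))⟩, mem_univ _⟩)
    (by rw [h b hbT.le, hzb])
  exact congrArg Prod.fst (key ⟨ht₀, hbt⟩)

lemma InverseProfile.mainPart_eq {f g h1 h2 h3 : ℝ → ℝ} {c M r : ℝ}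
    (P : InverseProfile f (invG g) (fun t => 1 / deriv g (invG g t))
      (fun t => ratioH g (invG g t)) h1 h2 h3 c M r) {t : ℝ} (ht : r < t) :
    mainPart g t = leadingPart (invG g) (fun t => 1 / deriv g (invG g t))
      (fun t => ratioH g (invG g t)) t := by
  have h1 : 0 < deriv g (invG g t) := by simpa using P.φ_pos t ht
  have h2 := P.pos_of_lt ht
  simp only [mainPart, leadingPart, phase]
  rw [one_div, Real.log_inv, Real.log_div h1.ne' h2.ne']
  ring

theorem proposition3p1 (f : ℝ → ℝ) (hf : IsNonlinearity f)
    (hG1 : CondG1 (logNonlin f)) (hG2 : CondG2 (logNonlin f)) :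
    (∃ Λ : ℝ, 0 < Λ ∧ ∃ y : ℝ → ℝ, IsODESolution f Λ y ∧
      ∀ ε : ℝ, 0 < ε → ε ≤ 1 / 2 → HasExpansion (logNonlin f) ε y) ∧
    (∀ (Λ : ℝ) (y₁ y₂ : ℝ → ℝ),
      IsODESolution f Λ y₁ → HasExpansion (logNonlin f) (1 / 2) y₁ →
      IsODESolution f Λ y₂ → HasExpansion (logNonlin f) (1 / 2) y₂ →
      EqOn y₁ y₂ (Ici Λ)) := by
  obtain ⟨h1, h2, h3, c, M, r, P⟩ := exists_inverseProfile hf hG1 hG2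
  set g := logNonlin f with hg
  set φ : ℝ → ℝ := fun t => 1 / deriv g (invG g t) with hφ
  set h : ℝ → ℝ := fun t => ratioH g (invG g t) with hh
  have hmain : ∀ t > r, mainPart g t = leadingPart (invG g) φ h t := fun t ht => P.mainPart_eq ht
  constructor
  · obtain ⟨y, z, Λ, C, hC, hrΛ, hy⟩ := P.exists_solution
    have hA : 0 < C * φ (r + 1) := mul_pos hC (P.φ_pos _ (by linarith))
    have hev : ∀ᶠ t in atTop, 0 ≤ y t := by
      filter_upwards [eventually_gt_atTop Λ, eventually_ge_atTop (r + 1), eventually_ge_atTop 1,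
        P.tendsto_leadingPart.eventually_ge_atTop 1,
        (tendsto_log_sq_div_sqrt.const_mul (C * φ (r + 1))).eventually_le_const (u := 1) (by simp)]
        with t a1 a2 a3 a4 a5
      have b1 := (hy t a1).2.2
      have b2 := P.φ_le_of_le (by linarith : r < r + 1) a2
      have b3 : C * φ t * Real.log t ^ 2 / t ≤ 1 := by
        calc _ ≤ C * φ (r + 1) * Real.log t ^ 2 / √t := by
              gcongr
              exact Real.sqrt_le_left (by linarith) |>.2 (by nlinarith)
          _ = C * φ (r + 1) * (Real.log t ^ 2 / √t) := by ring
          _ ≤ 1 := a5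
      have b4 := (abs_le.1 (b1.trans b3)).1
      linarith
    obtain ⟨T, hT⟩ := eventually_atTop.1 hev
    set Λ' := max (max Λ T) 0 + 1 with hΛ'
    have k1 : Λ < Λ' := by linarith [(le_max_left Λ T).trans (le_max_left (max Λ T) 0)]
    have k2 : T < Λ' := by linarith [(le_max_right Λ T).trans (le_max_left (max Λ T) 0)]
    have k3 : 0 < Λ' := by linarith [le_max_right (max Λ T) 0]
    refine ⟨Λ', k3, y, ⟨fun t ht => hT t (k2.le.trans ht), z, fun t ht => ?_⟩, fun ε hε _ => ?_⟩
    · obtain ⟨e1, e2, -⟩ := hy t (k1.trans_le ht)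
      exact ⟨e1.hasDerivWithinAt, e2.hasDerivWithinAt⟩
    · refine IsLittleO.of_bound fun K hK => ?_
      have hlog := (isLittleO_log_rpow_rpow_atTop (2 : ℝ) hε).def (div_pos hK hC)
      filter_upwards [hlog, eventually_gt_atTop Λ] with t a1 a2
      have htr : r < t := hrΛ.trans_lt a2
      have ht0 := P.pos_of_lt htr
      have hφt := P.φ_pos t htr
      rw [Real.rpow_two, Real.norm_eq_abs, Real.norm_eq_abs, abs_of_nonneg (sq_nonneg _),
        abs_of_pos (Real.rpow_pos_of_pos ht0 ε)] at a1
      have e1 : 1 / (t ^ (1 - ε) * deriv g (invG g t)) = φ t * t ^ ε / t := by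
        have e2 := Real.rpow_pos_of_pos ht0 ε
        rw [Real.rpow_sub ht0, Real.rpow_one]
        simp only [hφ]
        field_simp
      have e3 : 0 < φ t * t ^ ε / t := by
        have := Real.rpow_pos_of_pos ht0 ε
        positivity
      rw [e1, hmain t htr, Real.norm_eq_abs, Real.norm_eq_abs, abs_of_pos e3]
      calc _ ≤ C * φ t * Real.log t ^ 2 / t := (hy t a2).2.2
        _ ≤ C * φ t * (K / C * t ^ ε) / t := by gcongr
        _ = _ := by field_simp
  · intro Λ y₁ y₂ hy₁ he₁ hy₂ he₂
    have hexp : ∀ y, HasExpansion g (1 / 2) y →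
        (fun t => y t - leadingPart (invG g) φ h t) =o[atTop] (fun t => φ t / √t) := fun y hy => by
      refine hy.congr' ?_ ?_
      · filter_upwards [eventually_gt_atTop r] with t ht
        rw [hmain t ht]
      · filter_upwards with t
        rw [show (1 : ℝ) - 1 / 2 = 1 / 2 by norm_num, ← Real.sqrt_eq_rpow]
        simp only [hφ]
        field_simp
    have hat : ∀ {u : ℝ → ℝ} {u' t : ℝ}, Λ < t → HasDerivWithinAt u u' (Ici Λ) t →
        HasDerivAt u u' t := fun ht hu => hu.hasDerivAt (Ici_mem_nhds ht)
    obtain ⟨z₁, hz₁⟩ := hy₁.2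
    obtain ⟨z₂, hz₂⟩ := hy₂.2
    obtain ⟨T, hT⟩ := eventually_atTop.1 (P.eventually_eq_of_isLittleO
      (fun t ht => hat ht (hz₁ t ht.le).1) (fun t ht => hat ht (hz₁ t ht.le).2)
      (fun t ht => hat ht (hz₂ t ht.le).1) (fun t ht => hat ht (hz₂ t ht.le).2)
      (hexp y₁ he₁) (hexp y₂ he₂))
    exact hy₁.eqOn_of_eqOn_Ici hf hy₂ hT
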